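/- Let $N\ge 2$ and let $(V,g)$ be an $N$-dimensional real vector space with a time-oriented Lorentzian inner product of signature $(+,-,\dots,-)$ (for instance a tangent space of a Lorentzian manifold). Indices are raised and lowered with $g$; a bold letter $\boldsymbol{k}$ denotes the 1-form $k_a=g_{ab}k^b$ of a vector $\vec k$. A null vector is a non-zero $\vec k$ with $g(\vec k,\vec k)=0$; an eigenvector of a symmetric tensor $S_{ab}$ is a $\vec v\ne 0$ with $S_{ab}v^b=\mu v_a$ for some $\mu\in\mathbb R$. A symmetric tensor $S_{ab}$ has the dominant property if $S_{ab}u^av^b\ge 0$ for all future-pointing causal vectors $\vec u,\vec v$. A $p$-form is simple if it is the exterior product of $p$ linearly independent 1-forms. For a rank-$n$ form $A$ put $$(A\odot A)_{ab}=\frac{(-1)^{n-1}}{(n-1)!}A_{ac_2\dots c_n}A_b{}^{c_2\dots c_n}.$$ The superenergy tensor of a $p$-form $\Omega$ is $T_{ab}\{\Omega\}=\frac12\big(\Omega\odot\Omega+{*\Omega}\odot{*\Omega}\big)_{ab}$ if $1\le p\le N-1$, with $*$ the Hodge dual, and $T_{ab}\{\Omega\}=\frac12f^2g_{ab}$ if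 $p=N$ and $\Omega=f\eta$ with $\eta$ the volume form. **Theorem.** Let $S_{ab}$ be a symmetric tensor with the dominant property, and let $\vec k_1,\dots,\vec k_d$ ($0\le d\le N$) be a maximal family of linearly independent null eigenvectors of $S_{ab}$. Then there are a basis $\vec n_1,\dots,\vec n_N$ of $V$ consisting of null vectors, with $\vec n_i=\vec k_i$ for $i\le d$, and $p$-forms $\Omega_{[p]}$, $p=1,\dots,N$, each of them zero (the term is absent) or simple, such that $$S_{ab}=\sum_{p=1}^N T_{ab}\{\Omega_{[p]}\},$$ and such that: 1. for every $p>1$, $\Omega_{[p]}$ is a (possibly zero) real multiple of $\boldsymbol n_1\wedge\dots\wedge\boldsymbol n_p$; 2. if $d\ge 1$, then $\Omega_{[p]}=0$ for all $p<d$, and $\Omega_{[d]}=c\,\boldsymbol k_1\wedge\dots\wedge\boldsymbol k_d$ with $c\in\mathbb R$, where $c\neq 0$ if $S_{ab}\ne 0$; 3. if $d=0$, then $\Omega_{[1]}=\boldsymbol u$ for a timelike eigenvector $\vec u$ of $S_{ab}$ (in particular $\Omega_{[1]}\neq0$). -/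

import Mathlib

noncomputable section

namespace Superenergy

variable {V : Type*} [AddCommGroup V] [Module ℝ V] {N : ℕ}

/-- The signature `+, -, …, -`. -/
def sig (i : Fin N) : ℝ := if i.val = 0 then 1 else -1

/-- `e` is an orthonormal basis of the `N`-dimensional Lorentzian vector space `(V, g)`. Its
existence says that `g` is a Lorentzian metric of signature `+, -, …, -`; the vector `e 0` fixes the
time orientation. -/
def IsFrame (g : LinearMap.BilinForm ℝ V) (e : Module.Basis (Fin N) ℝ V) : Prop :=
  ∀ i j, g (e i) (e j) = if i = j then sig i else 0

/-- Timelike vectors. -/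
def IsTimelike (g : LinearMap.BilinForm ℝ V) (u : V) : Prop := 0 < g u u

/-- Null vectors (non-zero by convention). -/
def IsNull (g : LinearMap.BilinForm ℝ V) (k : V) : Prop := k ≠ 0 ∧ g k k = 0

/-- Causal (timelike or null) vectors pointing to the same side as the timelike vector `t`. -/
def IsFutureCausal (g : LinearMap.BilinForm ℝ V) (t u : V) : Prop := 0 ≤ g u u ∧ 0 < g t u

/-- The dominant property of a rank-2 tensor, the future being the side of the timelike vector
`t`. -/
def Dominant (g : LinearMap.BilinForm ℝ V) (t : V) (S : LinearMap.BilinForm ℝ V) : Prop :=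
  ∀ u v, IsFutureCausal g t u → IsFutureCausal g t v → 0 ≤ S u v

/-- `v` is an eigenvector of the tensor `S` with respect to `g`: `S_{ab} v^b = μ v_a`. -/
def IsEigenvector (g S : LinearMap.BilinForm ℝ V) (v : V) : Prop :=
  v ≠ 0 ∧ ∃ μ : ℝ, ∀ w, S w v = μ * g w v

/-- `k` lists a maximal number of linearly independent null eigenvectors of `S`. -/
def IsMaxNullEigenfamily (g S : LinearMap.BilinForm ℝ V) {d : ℕ} (k : Fin d → V) : Prop :=
  LinearIndependent ℝ k ∧ (∀ i, IsNull g (k i) ∧ IsEigenvector g S (k i)) ∧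
    ∀ v, IsNull g v → IsEigenvector g S v → v ∈ Submodule.span ℝ (Set.range k)

/-- The exterior product `ω 0 ∧ … ∧ ω (p - 1)` of 1-forms; its value at `x` is
`det (ω i (x j))`. -/
def wedge {p : ℕ} (ω : Fin p → Module.Dual ℝ V) : V [⋀^Fin p]→ₗ[ℝ] ℝ :=
  (Matrix.detRowAlternating (n := Fin p) (R := ℝ)).compLinearMap (LinearMap.pi ω)

/-- A simple `p`-form: an exterior product of `p` linearly independent 1-forms. -/
def IsSimple {p : ℕ} (Ω : V [⋀^Fin p]→ₗ[ℝ] ℝ) : Prop :=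
  ∃ ω : Fin p → Module.Dual ℝ V, LinearIndependent ℝ ω ∧ Ω = wedge ω

/-- The exterior product of the 1-forms `(k i)_a = g_{ab} (k i)^b` metrically equivalent to the
vectors `k i`. -/
def wedgeVec (g : LinearMap.BilinForm ℝ V) {p : ℕ} (k : Fin p → V) : V [⋀^Fin p]→ₗ[ℝ] ℝ :=
  wedge fun i => g (k i)

/-- The vectors `e^i`, with `v_a w^a = ∑ i, v (e i) * w (e^i)`, used to raise indices. -/
def raised (e : Module.Basis (Fin N) ℝ V) (i : Fin N) : V := sig i • e i

/-- The product
`(A ⊙ A)_{ab} = (-1)^{n-1} / (n-1)! * A_{a c_2 … c_n} A_b^{c_2 … c_n}`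
of a rank-`n` covariant tensor `A` with itself, `n ≥ 1`. -/
def odot (e : Module.Basis (Fin N) ℝ V) : {n : ℕ} → ((Fin n → V) → ℝ) → V → V → ℝ
  | 0, _, _, _ => 0
  | n + 1, A, x, y => (-1) ^ n / (n.factorial : ℝ) *
      ∑ c : Fin n → Fin N, A (Fin.cons x fun j => e (c j)) * A (Fin.cons y fun j => raised e (c j))

/-- The Hodge dual
`(*Ω)_{a_{p+1} … a_N} = (1 / p!) η_{a_1 … a_N} Ω^{a_1 … a_p}`,
where the volume form `η` is the one with `η (e 0, …, e (N - 1)) = 1`. -/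
def hodge (e : Module.Basis (Fin N) ℝ V) {p : ℕ} (Ω : V [⋀^Fin p]→ₗ[ℝ] ℝ)
    (y : Fin (N - p) → V) : ℝ :=
  1 / (p.factorial : ℝ) * ∑ c : Fin p → Fin N,
    e.det (fun i : Fin N => if h : i.val < p then e (c ⟨i.val, h⟩) else y ⟨i.val - p, by omega⟩) *
      Ω fun j => raised e (c j)

/-- The superenergy tensor of a `p`-form, `1 ≤ p ≤ N`:
`T{Ω} = (1/2) (Ω ⊙ Ω + *Ω ⊙ *Ω)` for `p < N`, and `T{f η} = (1/2) f^2 g` for `p = N`. -/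
def superenergy (g : LinearMap.BilinForm ℝ V) (e : Module.Basis (Fin N) ℝ V) {p : ℕ}
    (Ω : V [⋀^Fin p]→ₗ[ℝ] ℝ) (x y : V) : ℝ :=
  if h : p = N then 1 / 2 * (Ω fun i => e (Fin.cast h i)) ^ 2 * g x y
  else 1 / 2 * (odot e (fun z => Ω z) x y + odot e (hodge e Ω) x y)

end Superenergy

end

/-! For an orthonormal frame `f`, the superenergy tensor of `f 0 ∧ … ∧ f (p-1)` is half of the
diagonal tensor `∑ ± sig i • f i ⊗ f i`, with sign `+` for `i < p` and `-` otherwise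
(`superenergy_wedgeVec_frame`); that of a null 1-form `k` is `k ⊗ k` (`superenergy_null`). So it
suffices to bring `S` to the form `∑ ρ i * sig i • f i ⊗ f i + β k ⊗ k` with `k = f 0 + f 1`, `ρ`
decreasing, `ρ i ≥ -ρ 0`, `β ≥ 0`, and `ρ 1 = ρ 0` if `β ≠ 0` (`exists_normal_form`). Putting `-ρ 0`
after the last eigenvalue, the halved successive gaps are non-negative coefficients whose signed
sums telescope to `ρ` (`sum_coefficient`). If `β ≠ 0`, the first gap is zero, so rank 1 is free to
carry `k ⊗ k`.

The normal form starts from a causal eigenvector: for the largest `l` with `S - l g ≥ 0` on the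
future cone, this form vanishes at some future causal `u`, and its first variation there makes `u`
an eigenvector. If there is a timelike eigenvector, the spectral theorem on its negative definite
complement diagonalizes `S`. Otherwise `u` is null and `(S - l g) v` is a positive multiple of it
for some unit timelike `v`; the plane of `u` and `v` splits off.

Null eigenvectors are read off the normal form. If `β = 0`, they lie in the eigenspace of `ρ 0`,
spanned by the first `m` frame vectors; for `m ≥ 2` they span it, and for `m = 1` there are none. If
`β ≠ 0`, their only direction is `k`. A null basis adapted to the flag of `f` then gives the same
exterior products up to factors. -/

noncomputable section

namespace Superenergy

open Finset

/-! ### Exterior products, Hodge duals and their superenergy tensors -/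

section ExteriorProducts

variable {V : Type*} [AddCommGroup V] [Module ℝ V] {N : ℕ} {g : LinearMap.BilinForm ℝ V}
  {e : Module.Basis (Fin N) ℝ V}

lemma sig_mul_self (i : Fin N) : sig i * sig i = 1 := by
  unfold sig; split_ifs <;> norm_num

lemma IsFrame.apply_repr (he : IsFrame g e) (v : V) (i : Fin N) :
    g v (e i) = e.repr v i * sig i := by
  conv_lhs => rw [← e.sum_repr v]
  simp only [map_sum, map_smul, LinearMap.sum_apply, LinearMap.smul_apply, he _ i, smul_eq_mul,
    mul_ite, mul_zero, sum_ite_eq', mem_univ, if_true]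

lemma IsFrame.apply_eq_sum (he : IsFrame g e) (x y : V) :
    g x y = ∑ i, sig i * (g (e i) x * g (e i) y) := by
  have h : ∀ i y, g (e i) y = sig i * e.repr y i := fun i y => by
    conv_lhs => rw [← e.sum_repr y]
    simp only [map_sum, map_smul, he _ _, smul_eq_mul, mul_ite, mul_zero, sum_ite_eq, mem_univ,
      if_true]
    rw [mul_comm]
  conv_lhs => rw [← e.sum_repr x]
  simp only [map_sum, map_smul, LinearMap.sum_apply, LinearMap.smul_apply, h, smul_eq_mul]
  refine sum_congr rfl fun i _ => ?_
  linear_combination -(sig i * e.repr x i * e.repr y i) * sig_mul_self i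

lemma IsFrame.symm (he : IsFrame g e) (x y : V) : g x y = g y x := by
  rw [he.apply_eq_sum x y, he.apply_eq_sum y x]
  exact sum_congr rfl fun i _ => by ring

lemma IsFrame.sum_raised (he : IsFrame g e) (v : V) : ∑ i, g v (raised e i) • e i = v := by
  conv_rhs => rw [← e.sum_repr v]
  refine sum_congr rfl fun i _ => ?_
  rw [raised, map_smul, he.apply_repr, smul_eq_mul, mul_left_comm, sig_mul_self, mul_one]

/-- Expanding every argument in the frame and using multilinearity; this evaluates all the index
contractions below. -/
lemma IsFrame.contract (he : IsFrame g e) {n : ℕ} (A : MultilinearMap ℝ (fun _ : Fin n => V) ℝ)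
    (v : Fin n → V) :
    ∑ c : Fin n → Fin N, (∏ j, g (v j) (raised e (c j))) * A (fun j => e (c j)) = A v := by
  conv_rhs => rw [show v = fun j => ∑ i, g (v j) (raised e i) • e i from
    funext fun j => (he.sum_raised (v j)).symm]
  rw [A.map_sum]
  exact sum_congr rfl fun c _ => by rw [A.map_smul_univ]; rfl

lemma wedgeVec_apply {p : ℕ} (v x : Fin p → V) :
    wedgeVec g v x = Matrix.det (Matrix.of fun i j => g (v j) (x i)) := rfl

lemma wedgeVec_eq_sum {p : ℕ} (v x : Fin p → V) :
    wedgeVec g v x =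
      ∑ σ : Equiv.Perm (Fin p), (Equiv.Perm.sign σ : ℝ) * ∏ j, g (v (σ j)) (x j) := by
  rw [wedgeVec_apply, ← Matrix.det_transpose, Matrix.det_apply']
  simp

lemma sum_perm_apply_zero {n : ℕ} (F : Fin (n + 1) → ℝ) :
    ∑ σ : Equiv.Perm (Fin (n + 1)), F (σ 0) = n.factorial * ∑ i, F i := by
  rw [Finset.univ_perm_fin_succ, sum_map, ← univ_product_univ, sum_product, mul_sum]
  refine sum_congr rfl fun i _ => ?_
  simp [Fintype.card_perm]

/-- In the expansion over permutations `τ`, orthogonality kills every term in which `τ` differs from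
`σ` on some successor, and a permutation is determined by its values there. -/
lemma wedgeVec_cons_perm {n : ℕ} {v : Fin (n + 1) → V} {s : Fin (n + 1) → ℝ}
    (hv : ∀ i j, g (v i) (v j) = if i = j then s i else 0) (σ : Equiv.Perm (Fin (n + 1))) (x : V) :
    wedgeVec g v (Fin.cons x fun j => v (σ j.succ)) =
      (Equiv.Perm.sign σ : ℝ) * (g (v (σ 0)) x * ∏ j ∈ univ.erase (σ 0), s j) := by
  rw [wedgeVec_eq_sum, sum_eq_single σ]
  · rw [Fin.prod_univ_succ]
    simp only [Fin.cons_zero, Fin.cons_succ, hv, if_true]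
    congr 2
    refine prod_nbij (fun j => σ j.succ) (fun j _ => ?_) (fun i _ j _ h => ?_) (fun i hi => ?_)
      fun _ _ => rfl
    · simp
    · simpa using h
    · obtain ⟨l, rfl⟩ := σ.surjective i
      obtain ⟨j, rfl⟩ := Fin.exists_succ_eq.2 fun h : l = 0 => by simp [h] at hi
      exact ⟨j, by simp, rfl⟩
  · intro τ _ hτ
    obtain ⟨j, hj⟩ : ∃ j : Fin n, τ j.succ ≠ σ j.succ := by
      by_contra! h
      refine hτ (Equiv.ext fun i => ?_)
      refine Fin.cases ?_ h i
      by_contra h0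
      obtain ⟨l, hl⟩ := σ.surjective (τ 0)
      revert hl
      refine Fin.cases (fun hl => h0 hl.symm) (fun l hl => ?_) l
      rw [← h] at hl
      exact Fin.succ_ne_zero _ (τ.injective hl)
    rw [prod_eq_zero (mem_univ j.succ), mul_zero]
    simp [hv, hj]
  · simp

/-- The product `Ω ⊙ Ω` of an exterior product of mutually orthogonal vectors. -/
lemma IsFrame.odot_wedgeVec (he : IsFrame g e) {n : ℕ} {v : Fin (n + 1) → V} {s : Fin (n + 1) → ℝ}
    (hv : ∀ i j, g (v i) (v j) = if i = j then s i else 0) (x y : V) :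
    odot e (fun z => wedgeVec g v z) x y =
      (-1) ^ n * ∑ i, (∏ j ∈ univ.erase i, s j) * (g (v i) x * g (v i) y) := by
  have h1 : ∑ c : Fin n → Fin N, wedgeVec g v (Fin.cons x fun j => e (c j)) *
      wedgeVec g v (Fin.cons y fun j => raised e (c j)) =
      ∑ σ : Equiv.Perm (Fin (n + 1)),
        (∏ j ∈ univ.erase (σ 0), s j) * (g (v (σ 0)) x * g (v (σ 0)) y) := by
    simp_rw [wedgeVec_eq_sum v (Fin.cons y _), mul_sum]
    rw [sum_comm]
    refine sum_congr rfl fun σ _ => ?_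
    -- For each `σ` in the expansion of the second factor, the sum over `c` substitutes the vectors
    -- `v (σ j.succ)` into the first factor.
    have h2 := he.contract ((wedgeVec g v).curryLeft x).toMultilinearMap fun j => v (σ j.succ)
    have h3 := wedgeVec_cons_perm hv σ x
    change _ = wedgeVec g v (Fin.cons x fun j => v (σ j.succ)) at h2
    rw [h3] at h2
    have h4 : (Equiv.Perm.sign σ : ℝ) * (Equiv.Perm.sign σ : ℝ) = 1 := by
      rcases Int.units_eq_one_or (Equiv.Perm.sign σ) with h | h <;> simp [h]
    calc _ = (Equiv.Perm.sign σ : ℝ) * g (v (σ 0)) y * ∑ c : Fin n → Fin N,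
          (∏ j : Fin n, g (v (σ j.succ)) (raised e (c j))) *
            wedgeVec g v (Fin.cons x fun j => e (c j)) := by
          rw [mul_sum]
          refine sum_congr rfl fun c _ => ?_
          rw [Fin.prod_univ_succ]
          simp only [Fin.cons_zero, Fin.cons_succ]
          ring
      _ = _ := by
          refine (congrArg _ h2).trans ?_
          linear_combination (∏ j ∈ univ.erase (σ 0), s j) * (g (v (σ 0)) x * g (v (σ 0)) y) * h4
  rw [odot, h1, sum_perm_apply_zero
    (fun i => (∏ j ∈ univ.erase i, s j) * (g (v i) x * g (v i) y))]
  have : (n.factorial : ℝ) ≠ 0 := by positivity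
  field_simp

lemma append_update_left {α : Type*} {p q : ℕ} (z : Fin p → α) (y : Fin q → α) (i : Fin p)
    (a : α) :
    Fin.append (Function.update z i a) y =
      Function.update (Fin.append z y) (Fin.castAdd q i) a := by
  funext l
  refine Fin.addCases (fun l => ?_) (fun l => ?_) l
  · by_cases h : l = i
    · subst h; simp
    · simp [Function.update_of_ne, h]
  · rw [Function.update_of_ne]
    · simp
    · exact fun h => absurd (congrArg Fin.val h) (by simp; omega)

/-- An alternating form with its last arguments fixed. -/
def fixLast {p q : ℕ} (D : V [⋀^Fin (p + q)]→ₗ[ℝ] ℝ) (y : Fin q → V) : V [⋀^Fin p]→ₗ[ℝ] ℝ where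
  toFun z := D (Fin.append z y)
  map_update_add' {inst} z i a b := by
    rw [Subsingleton.elim inst (instDecidableEqFin p)]
    simp only [append_update_left, D.map_update_add]
  map_update_smul' {inst} z i a b := by
    rw [Subsingleton.elim inst (instDecidableEqFin p)]
    simp only [append_update_left, D.map_update_smul]
  map_eq_zero_of_eq' z i j h hij := by
    refine D.map_eq_zero_of_eq _ (i := Fin.castAdd q i) (j := Fin.castAdd q j) ?_ ?_
    · simpa using h
    · simpa using hij

/-- The Hodge dual with the rank of its value as a free parameter. -/
def hodgeOfRank (e : Module.Basis (Fin N) ℝ V) {p q : ℕ} (h : p + q = N)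
    (Ω : V [⋀^Fin p]→ₗ[ℝ] ℝ) (y : Fin q → V) : ℝ :=
  1 / (p.factorial : ℝ) * ∑ c : Fin p → Fin N,
    e.det (fun i : Fin N => if h : i.val < p then e (c ⟨i.val, h⟩) else y ⟨i.val - p, by omega⟩) *
      Ω fun j => raised e (c j)

lemma superenergy_of_lt {p q : ℕ} (h : p + q = N) (hq : 0 < q) (Ω : V [⋀^Fin p]→ₗ[ℝ] ℝ)
    (x y : V) : superenergy g e Ω x y =
      1 / 2 * (odot e (fun z => Ω z) x y + odot e (hodgeOfRank e h Ω) x y) := by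
  obtain rfl : q = N - p := by omega
  rw [superenergy, dif_neg (by omega)]
  rfl

/-- The Hodge dual of an exterior product. -/
lemma IsFrame.hodgeOfRank_wedgeVec {p q : ℕ} {e : Module.Basis (Fin (p + q)) ℝ V}
    (he : IsFrame g e) (v : Fin p → V) (y : Fin q → V) :
    hodgeOfRank e rfl (wedgeVec g v) y = e.det (Fin.append v y) := by
  have h1 : ∀ z : Fin p → V, (fun i : Fin (p + q) => if h : i.val < p then z ⟨i.val, h⟩ else
      y ⟨i.val - p, by omega⟩) = Fin.append z y := by
    refine fun z => funext fun i => ?_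
    refine Fin.addCases (fun i => ?_) (fun i => ?_) i <;> simp
  have h2 : ∑ c : Fin p → Fin (p + q), e.det (Fin.append (fun j => e (c j)) y) *
      wedgeVec g v (fun j => raised e (c j)) =
      ∑ σ : Equiv.Perm (Fin p), e.det (Fin.append v y) := by
    simp_rw [wedgeVec_eq_sum v, mul_sum]
    rw [sum_comm]
    refine sum_congr rfl fun σ _ => ?_
    have h3 := he.contract (fixLast e.det y).toMultilinearMap fun j => v (σ j)
    have h4 : e.det (Fin.append (fun j => v (σ j)) y) =
        (Equiv.Perm.sign σ : ℝ) * e.det (Fin.append v y) := by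
      have := (fixLast e.det y).map_perm v σ
      rw [Units.smul_def, zsmul_eq_mul] at this
      exact this
    change ∑ c : Fin p → Fin (p + q), _ * e.det (Fin.append (fun j => e (c j)) y) =
      e.det (Fin.append (fun j => v (σ j)) y) at h3
    have h5 : (Equiv.Perm.sign σ : ℝ) * (Equiv.Perm.sign σ : ℝ) = 1 := by
      rcases Int.units_eq_one_or (Equiv.Perm.sign σ) with h | h <;> simp [h]
    calc _ = (Equiv.Perm.sign σ : ℝ) * ∑ c : Fin p → Fin (p + q),
          (∏ j, g (v (σ j)) (raised e (c j))) * e.det (Fin.append (fun j => e (c j)) y) := by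
          rw [mul_sum]
          exact sum_congr rfl fun c _ => by ring
      _ = _ := by rw [h3, h4, ← mul_assoc, h5, one_mul]
  simp_rw [hodgeOfRank]
  rw [← h1] at h2
  simp_rw [fun c : Fin p → Fin (p + q) => h1 fun j => e (c j)]
  rw [h2, h1]
  simp only [sum_const, card_univ, Fintype.card_perm, Fintype.card_fin, nsmul_eq_mul]
  have : (p.factorial : ℝ) ≠ 0 := by positivity
  field_simp

/-- If the vectors `v` are orthogonal to the last vectors of `w`, the exterior product of `w`
contracted with `v` is a multiple of the exterior product of these last vectors. -/
lemma wedgeVec_append {p q : ℕ} (w : Fin (p + q) → V) (v : Fin p → V) (y : Fin q → V)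
    (h : ∀ i j, g (w (Fin.natAdd p i)) (v j) = 0) :
    wedgeVec g w (Fin.append v y) =
      wedgeVec g (fun i => w (Fin.castAdd q i)) v * wedgeVec g (fun i => w (Fin.natAdd p i)) y := by
  simp only [wedgeVec_apply]
  -- The matrix is block triangular: the block pairing `v` with the last vectors of `w` vanishes.
  rw [← Matrix.det_submatrix_equiv_self finSumFinEquiv, ← Matrix.fromBlocks_toBlocks
    (Matrix.submatrix _ _ _), ← Matrix.det_fromBlocks_zero₁₂ _
    (Matrix.of fun i j => g (w (Fin.castAdd q j)) (y i))]
  congr 1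
  ext i j
  rcases i with i | i <;> rcases j with j | j <;> simp [Matrix.toBlocks₁₁, Matrix.toBlocks₁₂,
    Matrix.toBlocks₂₁, Matrix.toBlocks₂₂, h]

lemma IsFrame.wedgeVec_self_sq {f : Module.Basis (Fin N) ℝ V} (hf : IsFrame g f) :
    wedgeVec g f f ^ 2 = 1 := by
  have : wedgeVec g f f = ∏ i : Fin N, sig i := by
    rw [wedgeVec_apply, ← Matrix.det_diagonal]
    congr 1
    ext i j
    rcases eq_or_ne i j with rfl | h
    · simp [hf _ _]
    · simp [hf _ _, h, h.symm]
  rw [this, sq, ← prod_mul_distrib]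
  simp [sig_mul_self]

/-- The exterior product of an orthonormal basis is the volume form up to sign. -/
lemma IsFrame.wedgeVec_eq_det (he : IsFrame g e) {f : Module.Basis (Fin N) ℝ V}
    (hf : IsFrame g f) : wedgeVec g f e ^ 2 = 1 := by
  have h1 : wedgeVec g f f = wedgeVec g f e * e.det f := by
    conv_lhs => rw [(wedgeVec g f).eq_smul_basis_det e]
    rfl
  have h2 : wedgeVec g e f = wedgeVec g e e * e.det f := by
    conv_lhs => rw [(wedgeVec g e).eq_smul_basis_det e]
    rfl
  have h3 : wedgeVec g e f = wedgeVec g f e := by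
    rw [wedgeVec_apply, wedgeVec_apply, ← Matrix.det_transpose]
    congr 1
    ext i j
    simp [he.symm (e i)]
  have h4 := hf.wedgeVec_self_sq
  have h5 := he.wedgeVec_self_sq
  rw [h3] at h2
  rw [h1] at h4
  -- By `h2`, the determinant of `f` in the basis `e` has the same square as `wedgeVec g f e`; by
  -- `h4`, the product of the two squares is `1`.
  have h6 : (wedgeVec g f e ^ 2) ^ 2 = 1 := by
    have h7 := congrArg (· ^ 2) h2
    simp only [mul_pow, h5, one_mul] at h7 h4
    rw [← h7] at h4
    rw [sq, h4]
  nlinarith [sq_nonneg (wedgeVec g f e)]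

lemma odot_const_mul {n : ℕ} (a : ℝ) (A : (Fin n → V) → ℝ) (x y : V) :
    odot e (fun z => a * A z) x y = a ^ 2 * odot e A x y := by
  cases n with
  | zero => simp [odot]
  | succ n =>
    simp only [odot, mul_sum]
    exact sum_congr rfl fun c _ => by ring

lemma hodge_smul {p : ℕ} (a : ℝ) (Ω : V [⋀^Fin p]→ₗ[ℝ] ℝ) :
    hodge e (a • Ω) = fun z => a * hodge e Ω z := by
  funext z
  simp only [hodge, mul_sum, AlternatingMap.smul_apply, smul_eq_mul]
  exact sum_congr rfl fun c _ => by ring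

lemma superenergy_smul {p : ℕ} (a : ℝ) (Ω : V [⋀^Fin p]→ₗ[ℝ] ℝ) (x y : V) :
    superenergy g e (a • Ω) x y = a ^ 2 * superenergy g e Ω x y := by
  unfold superenergy
  split_ifs with h
  · simp only [AlternatingMap.smul_apply, smul_eq_mul]; ring
  · rw [hodge_smul, odot_const_mul]
    simp only [AlternatingMap.smul_apply, smul_eq_mul, odot_const_mul]
    ring

/-- The superenergy tensor of an exterior product of mutually orthogonal vectors. -/
lemma IsFrame.superenergy_wedgeVec {n m : ℕ} {e : Module.Basis (Fin (n + 1 + (m + 1))) ℝ V}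
    (he : IsFrame g e) {v : Fin (n + 1) → V} {w : Fin (n + 1 + (m + 1)) → V}
    {s : Fin (n + 1) → ℝ} {t : Fin (m + 1) → ℝ}
    (hv : ∀ i j, g (v i) (v j) = if i = j then s i else 0)
    (hw : ∀ i j, g (w (Fin.natAdd (n + 1) i)) (w (Fin.natAdd (n + 1) j)) =
      if i = j then t i else 0)
    (hwv : ∀ i j, g (w (Fin.natAdd (n + 1) i)) (v j) = 0)
    (hwe : wedgeVec g w e ^ 2 = 1)
    (hdet : wedgeVec g (fun i => w (Fin.castAdd (m + 1) i)) v ^ 2 = 1) (x y : V) :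
    superenergy g e (wedgeVec g v) x y =
      1 / 2 * ((-1) ^ n * ∑ i, (∏ j ∈ univ.erase i, s j) * (g (v i) x * g (v i) y) +
        (-1) ^ m * ∑ i, (∏ j ∈ univ.erase i, t j) *
          (g (w (Fin.natAdd (n + 1) i)) x * g (w (Fin.natAdd (n + 1) i)) y)) := by
  -- The product of all the `w` is the volume form up to sign, so the Hodge dual of the `v` can be
  -- computed with it; `w` may thus be chosen to suit `v`.
  have h1 : ∀ z, hodgeOfRank e rfl (wedgeVec g v) z =
      wedgeVec g w e * wedgeVec g (fun i => w (Fin.castAdd (m + 1) i)) v *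
        wedgeVec g (fun i => w (Fin.natAdd (n + 1) i)) z := fun z => by
    have h2 : wedgeVec g w (Fin.append v z) = wedgeVec g w e * e.det (Fin.append v z) := by
      conv_lhs => rw [(wedgeVec g w).eq_smul_basis_det e]
      rfl
    rw [wedgeVec_append w v z hwv] at h2
    rw [he.hodgeOfRank_wedgeVec, mul_assoc, h2, ← mul_assoc, ← sq, hwe, one_mul]
  rw [superenergy_of_lt rfl (by omega), funext h1, odot_const_mul, he.odot_wedgeVec hv,
    he.odot_wedgeVec hw, mul_pow, hwe, hdet, one_mul, one_mul]

/-- The superenergy tensor of the exterior product of the first vectors of an orthonormal basis. -/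
lemma IsFrame.superenergy_wedgeVec_frame (he : IsFrame g e) {f : Module.Basis (Fin N) ℝ V}
    (hf : IsFrame g f) {p : ℕ} (hp : 1 ≤ p) (hpN : p ≤ N) (x y : V) :
    superenergy g e (wedgeVec g fun i : Fin p => f (Fin.castLE hpN i)) x y =
      1 / 2 * ∑ i : Fin N, (if i.val < p then 1 else -1) * (sig i * (g (f i) x * g (f i) y)) := by
  rcases hpN.eq_or_lt with rfl | hlt
  · have h := he.wedgeVec_eq_det hf
    rw [superenergy, dif_pos rfl, hf.apply_eq_sum x y]
    simp only [Fin.castLE_rfl, Fin.cast_eq_self, id_eq, Fin.is_lt, if_true, one_mul]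
    erw [h]
    rw [mul_one]
  · obtain ⟨n, rfl⟩ : ∃ n, p = n + 1 := ⟨p - 1, by omega⟩
    obtain ⟨m, rfl⟩ : ∃ m, N = n + 1 + (m + 1) := ⟨N - (n + 1) - 1, by omega⟩
    have hc : ∀ i : Fin (n + 1), Fin.castLE hpN i = Fin.castAdd (m + 1) i := fun i => rfl
    have hsn : ∀ i : Fin (m + 1), sig (Fin.natAdd (n + 1) i) = -1 := fun i => by simp [sig]
    have hprod : ∏ j : Fin (n + 1), sig (Fin.castAdd (m + 1) j) = (-1) ^ n := by
      rw [Fin.prod_univ_succ]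
      simp [sig]
    rw [he.superenergy_wedgeVec (w := f) (s := fun i => sig (Fin.castAdd (m + 1) i))
      (t := fun _ => -1), Fin.sum_univ_add (a := n + 1) (b := m + 1)]
    · refine congrArg _ (congrArg₂ _ ?_ ?_)
      · rw [mul_sum]
        refine sum_congr rfl fun i _ => ?_
        have h2 := mul_prod_erase univ (fun j => sig (Fin.castAdd (m + 1) j)) (mem_univ i)
        have h3 : (-1 : ℝ) ^ n * (-1) ^ n = 1 := by rw [← mul_pow]; simp
        rw [hprod] at h2
        have h4 := sig_mul_self (Fin.castAdd (m + 1) i)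
        have h5 : (-1) ^ n * ∏ j ∈ univ.erase i, sig (Fin.castAdd (m + 1) j) =
            sig (Fin.castAdd (m + 1) i) := by
          linear_combination (-1) ^ n * sig (Fin.castAdd (m + 1) i) * h2 -
            (-1) ^ n * (∏ j ∈ univ.erase i, sig (Fin.castAdd (m + 1) j)) * h4 +
            sig (Fin.castAdd (m + 1) i) * h3
        rw [← mul_assoc, h5, hc, if_pos (by simp; omega), one_mul]
      · rw [mul_sum]
        refine sum_congr rfl fun i _ => ?_
        have h3 : (-1 : ℝ) ^ m * (-1) ^ m = 1 := by rw [← mul_pow]; simp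
        rw [hsn, if_neg (by simp; omega)]
        simp [← mul_assoc, h3]
    · intro i j
      simp [hf _ _, hc]
    · intro i j
      simp [hf _ _, hsn]
    · intro i j
      rw [hf, if_neg]
      exact fun h => absurd (congrArg Fin.val h) (by simp [hc]; omega)
    · exact he.wedgeVec_eq_det hf
    · simp_rw [hc]
      have : wedgeVec g (fun i => f (Fin.castAdd (m + 1) i))
          (fun i => f (Fin.castAdd (m + 1) i)) = (-1) ^ n := by
        rw [← hprod, wedgeVec_apply, ← Matrix.det_diagonal]
        congr 1
        ext i j
        rcases eq_or_ne i j with rfl | h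
        · simp [hf _ _]
        · simp [hf _ _, h, h.symm]
      rw [this, ← pow_mul, mul_comm, pow_mul]
      simp

/-- The superenergy tensor of a null 1-form. -/
lemma IsFrame.superenergy_null (he : IsFrame g e) {f : Module.Basis (Fin N) ℝ V}
    (hf : IsFrame g f) {i₀ i₁ : Fin N} (h₀ : i₀.val = 0) (h₁ : i₁.val = 1) (x y : V) :
    superenergy g e (wedgeVec g fun _ : Fin 1 => f i₀ + f i₁) x y =
      g (f i₀ + f i₁) x * g (f i₀ + f i₁) y := by
  obtain ⟨m, rfl⟩ : ∃ m, N = 0 + 1 + (m + 1) := ⟨N - 2, by omega⟩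
  have h01 : i₀ ≠ i₁ := fun h => by simp [h, h₁] at h₀
  obtain ⟨k, hk⟩ : ∃ k, k = f i₀ + f i₁ := ⟨_, rfl⟩
  rw [← hk]
  have hk0 : ∀ i, i ≠ i₀ → i ≠ i₁ → g (f i) k = 0 := by
    intro i h0 h1
    rw [hk, map_add, hf, hf, if_neg h0, if_neg h1, add_zero]
  have h00 : g (f i₀) k = 1 := by
    rw [hk, map_add, hf, hf]; simp [sig, h01, h₀]
  have h10 : g (f i₁) k = -1 := by
    rw [hk, map_add, hf, hf]; simp [sig, h01.symm, h₁]
  have hkk : g (f i₀ + f i₁) k = 0 := by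
    rw [map_add, LinearMap.add_apply, h00, h10]; norm_num
  rw [← hk] at hkk
  have hi1 : Fin.natAdd (0 + 1) (0 : Fin (m + 1)) = i₁ := Fin.ext (by simp [h₁])
  -- Replacing `f i₁` by `k` makes the last vectors of `w` mutually orthogonal and orthogonal to
  -- `k`. As `k` has norm zero, only its own term survives in the dual, so both halves of the
  -- superenergy tensor equal `k ⊗ k`.
  obtain ⟨w, hw⟩ : ∃ w, w = (Function.update f i₁ k : Fin _ → V) := ⟨_, rfl⟩
  have hw1 : ∀ i : Fin (m + 1), i ≠ 0 → w (Fin.natAdd (0 + 1) i) = f (Fin.natAdd (0 + 1) i) :=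
    fun i hi => by
      rw [hw, Function.update_of_ne]
      rw [← hi1]
      exact fun h => hi (by simpa using h)
  have hw0 : w (Fin.natAdd (0 + 1) 0) = k := by rw [hi1, hw, Function.update_self]
  have hwk : ∀ i, g (w (Fin.natAdd (0 + 1) i)) k = 0 := fun i => by
    rcases eq_or_ne i 0 with rfl | hi
    · rw [hw0, hkk]
    · rw [hw1 i hi, hk0 _ (fun h => ?_) (fun h => hi ?_)]
      · have := congrArg Fin.val h
        simp only [Fin.val_natAdd] at this
        omega
      · rw [← hi1] at h
        simpa using h
  rw [he.superenergy_wedgeVec (w := w) (s := fun _ => 0) (t := fun i => if i = 0 then 0 else -1)]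
  · have h3 : (-1 : ℝ) ^ m * (-1) ^ m = 1 := by rw [← mul_pow]; simp
    rw [sum_eq_single (a := (0 : Fin (m + 1))) _ (by simp), hw0,
      prod_congr rfl (g := fun _ => -1) fun j hj => if_neg (ne_of_mem_erase hj)]
    · simp
      linear_combination (1 / 2) * g k x * g k y * h3
    · intro i _ hi
      have : ∏ j ∈ univ.erase i, (if j = 0 then 0 else -1 : ℝ) = 0 :=
        prod_eq_zero (mem_erase.2 ⟨hi.symm, mem_univ 0⟩) (if_pos rfl)
      rw [this, zero_mul]
  · simp [hkk]
  · intro i j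
    rcases eq_or_ne j 0 with rfl | hj
    · rw [hw0, hwk]
      split_ifs <;> rfl
    · rcases eq_or_ne i 0 with rfl | hi
      · rw [he.symm, hw0, hwk, if_neg hj.symm]
      · rw [hw1 i hi, hw1 j hj, hf, if_neg hi]
        simp [sig]
  · exact fun i _ => hwk i
  -- Adding `f i₀` to `f i₁` is a column operation, so the volume is unchanged.
  · have h2 := Matrix.det_updateCol_add_self (Matrix.of fun i j => g (f j) (e i)) h01.symm
    rw [← he.wedgeVec_eq_det hf, wedgeVec_apply, wedgeVec_apply, ← h2]
    congr 2
    ext i j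
    rcases eq_or_ne j i₁ with rfl | hj
    · simp [hk, hw, add_comm]
    · simp [hj, hw]
  · have h2 : Fin.castAdd (m + 1) (0 : Fin (0 + 1)) = i₀ := Fin.ext (by simp [h₀])
    have h3 : wedgeVec g (fun i => w (Fin.castAdd (m + 1) i)) (fun _ : Fin (0 + 1) => k) =
      g (w (Fin.castAdd (m + 1) 0)) k := Matrix.det_fin_one _
    rw [h3, h2, hw, Function.update_of_ne h01, h00, one_pow]

end ExteriorProducts

/-! ### Diagonalization on negative definite subspaces -/

section Spectral

variable {V : Type*} [AddCommGroup V] [Module ℝ V] {N : ℕ} {g : LinearMap.BilinForm ℝ V}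

/-- A symmetric bilinear form is diagonalizable on a negative definite subspace. -/
lemma exists_diagonal_of_negDef [FiniteDimensional ℝ V] (S : LinearMap.BilinForm ℝ V)
    (hg : ∀ x y, g x y = g y x) (hS : ∀ x y, S x y = S y x) (U : Submodule ℝ V)
    (hU : ∀ x ∈ U, x ≠ 0 → g x x < 0) {r : ℕ} (hr : Module.finrank ℝ U = r) :
    ∃ (w : Fin r → V) (ρ : Fin r → ℝ), (∀ i, w i ∈ U) ∧ Antitone ρ ∧
      (∀ i j, g (w i) (w j) = if i = j then -1 else 0) ∧
      ∀ i j, S (w i) (w j) = if i = j then -ρ i else 0 := by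
  let core : InnerProductSpace.Core ℝ U :=
    { inner := fun x y => -g x y
      conj_inner_symm := fun x y => by simp [hg (x : V)]
      re_inner_nonneg := fun x => by
        rcases eq_or_ne x 0 with rfl | hx
        · simp
        · have := hU x x.2 (by simpa using hx)
          simpa using this.le
      add_left := fun x y z => by simp; ring
      smul_left := fun x y c => by simp
      definite := fun x hx => by
        by_contra h
        have := hU x x.2 (by simpa using h)
        simp only [neg_eq_zero] at hx
        exact this.ne hx }
  let _ : NormedAddCommGroup U := core.toNormedAddCommGroup
  let _ : InnerProductSpace ℝ U := InnerProductSpace.ofCore core.toCore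
  have hinner : ∀ x y : U, inner ℝ x y = -g x y := fun _ _ => rfl
  let h : LinearMap.BilinForm ℝ U := -(g.restrict U)
  have hnd : h.Nondegenerate := by
    have key : ∀ x : U, h x x = 0 → x = 0 := fun x hx => by
      by_contra hne
      exact (hU x x.2 (by simpa using hne)).ne (neg_eq_zero.1 hx)
    exact ⟨fun x hx => key x (hx x), fun x hx => key x (hx x)⟩
  -- The operator representing `S` on `U` is self-adjoint for the inner product `-g`, so the
  -- spectral theorem applies.
  let T : U →ₗ[ℝ] U := (-(S.restrict U)).symmCompOfNondegenerate h hnd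
  have hT : ∀ x y : U, -g (T x) y = -S x y := fun x y =>
    LinearMap.BilinForm.symmCompOfNondegenerate_left_apply (-(S.restrict U)) hnd y x
  have hsym : T.IsSymmetric := fun x y => by
    rw [hinner, hinner, hT, hg, hT, hS]
  let b := hsym.eigenvectorBasis hr
  have hb : ∀ i j, -g (b i) (b j) = if i = j then 1 else 0 := fun i j => by
    rw [← hinner]
    exact orthonormal_iff_ite.1 b.orthonormal i j
  refine ⟨fun i => b i, hsym.eigenvalues hr, fun i => (b i).2, hsym.eigenvalues_antitone hr,
    fun i j => ?_, fun i j => ?_⟩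
  · have := hb i j
    split_ifs at this ⊢ <;> linarith
  · have h1 := hT (b i) (b j)
    rw [hsym.apply_eigenvectorBasis hr i] at h1
    have h2 := hb i j
    simp only [RCLike.ofReal_real_eq_id, id, Submodule.coe_smul, map_smul, LinearMap.smul_apply,
      smul_eq_mul] at h1
    change -(_ * g (b i) (b j)) = _ at h1
    split_ifs at h2 ⊢ with hij
    · linear_combination h1 - hsym.eigenvalues hr i * h2
    · linear_combination h1 - hsym.eigenvalues hr i * h2

/-- Orthonormal vectors in the right number are a frame. -/
lemma exists_frame_of_orthonormal [FiniteDimensional ℝ V] (hN : Module.finrank ℝ V = N)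
    (f : Fin N → V) (hf : ∀ i j, g (f i) (f j) = if i = j then sig i else 0) :
    ∃ b : Module.Basis (Fin N) ℝ V, ⇑b = f ∧ IsFrame g b := by
  have hli : LinearIndependent ℝ f := by
    rw [Fintype.linearIndependent_iff]
    intro c hc i
    have h1 : g (f i) (∑ j, c j • f j) = 0 := by rw [hc, map_zero]
    simp only [map_sum, map_smul, hf, smul_eq_mul, mul_ite, mul_zero, sum_ite_eq, mem_univ,
      if_true] at h1
    have := sig_mul_self i
    exact (mul_eq_zero.1 h1).resolve_right fun h => by simp [h] at this
  refine ⟨basisOfLinearIndependentOfCardEqFinrank' f hli (by simp [hN]), by simp, fun i j => ?_⟩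
  simp [hf]

/-! ### The causal cone, causal eigenvectors and adapted frames -/

section Cone

variable {n : ℕ} {e : Module.Basis (Fin (n + 1)) ℝ V}

lemma IsFrame.apply_eq_sub (he : IsFrame g e) (x y : V) :
    g x y = g (e 0) x * g (e 0) y - ∑ j : Fin n, g (e j.succ) x * g (e j.succ) y := by
  rw [he.apply_eq_sum, Fin.sum_univ_succ]
  simp [sig, sub_eq_add_neg]

/-- Cauchy–Schwarz for the spatial components, which a causal vector bounds by its time component.
-/
lemma IsFrame.abs_sum_le (he : IsFrame g e) {x y : V} (hx : 0 ≤ g x x) (hy : 0 ≤ g y y) :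
    |∑ j : Fin n, g (e j.succ) x * g (e j.succ) y| ≤ |g (e 0) x * g (e 0) y| := by
  rw [he.apply_eq_sub] at hx hy
  have h1 := sum_mul_sq_le_sq_mul_sq univ (fun j : Fin n => g (e j.succ) x)
    fun j => g (e j.succ) y
  refine sq_le_sq.1 (h1.trans ?_)
  rw [mul_pow]
  refine mul_le_mul ?_ ?_ (sum_nonneg fun _ _ => sq_nonneg _) (sq_nonneg _)
  · simp only [sq]; linarith
  · simp only [sq]; linarith

/-- Cauchy–Schwarz again, now strict because `u` is timelike: the orthogonal complement of `u` is
negative definite. -/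
lemma IsFrame.eq_zero_of_orthogonal (he : IsFrame g e) {u x : V} (hu : 0 < g u u)
    (hux : g u x = 0) (hx : 0 ≤ g x x) : x = 0 := by
  have h1 := sum_mul_sq_le_sq_mul_sq univ (fun j : Fin n => g (e j.succ) u)
    fun j => g (e j.succ) x
  rw [he.apply_eq_sub] at hu hux hx
  simp only [← sq] at hu hx
  set P := ∑ j : Fin n, g (e j.succ) u ^ 2
  set R := ∑ j : Fin n, g (e j.succ) x ^ 2 with hR
  have hR0 : 0 ≤ R := sum_nonneg fun _ _ => sq_nonneg _
  have hP0 : 0 ≤ P := sum_nonneg fun _ _ => sq_nonneg _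
  rw [← sub_eq_zero.1 hux, mul_pow] at h1
  have h2 : g (e 0) x = 0 := by
    by_contra h
    have h3 : 0 < g (e 0) x ^ 2 := by positivity
    nlinarith
  have h3 : R = 0 := by rw [h2] at hx; nlinarith
  rw [hR, sum_eq_zero_iff_of_nonneg fun _ _ => sq_nonneg _] at h3
  rw [← he.sum_raised x]
  refine sum_eq_zero fun i _ => ?_
  rw [raised, map_smul, he.symm]
  refine Fin.cases ?_ (fun j => ?_) i
  · simp [h2]
  · simp [pow_eq_zero_iff two_ne_zero |>.1 (h3 j (mem_univ _))]

lemma IsFrame.eq_zero_of_orthogonal' {e : Module.Basis (Fin N) ℝ V} (he : IsFrame g e) {u x : V}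
    (hu : 0 < g u u) (hux : g u x = 0) (hx : 0 ≤ g x x) : x = 0 := by
  cases N with
  | zero => rw [← e.sum_repr x]; simp
  | succ n => exact he.eq_zero_of_orthogonal hu hux hx

lemma IsFrame.future_of_pos (he : IsFrame g e) {u v : V} (hu : IsFutureCausal g (e 0) u)
    (hv : 0 ≤ g v v) (huv : 0 < g u v) : IsFutureCausal g (e 0) v := by
  refine ⟨hv, ?_⟩
  by_contra! h
  have h1 := he.abs_sum_le hu.1 hv
  rw [he.apply_eq_sub] at huv
  rw [abs_of_nonpos (mul_nonpos_of_nonneg_of_nonpos hu.2.le h)] at h1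
  linarith [(abs_le.1 h1).1]

lemma IsFrame.nonneg_of_future (he : IsFrame g e) {u v : V} (hu : IsFutureCausal g (e 0) u)
    (hv : IsFutureCausal g (e 0) v) : 0 ≤ g u v := by
  have h1 := he.abs_sum_le hu.1 hv.1
  rw [he.apply_eq_sub, sub_nonneg]
  rw [abs_of_nonneg (mul_nonneg hu.2.le hv.2.le)] at h1
  exact (abs_le.1 h1).2

lemma IsFrame.future_add (he : IsFrame g e) {u v : V} (hu : IsFutureCausal g (e 0) u)
    (hv : IsFutureCausal g (e 0) v) : IsFutureCausal g (e 0) (u + v) := by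
  have h1 := he.nonneg_of_future hu hv
  have h2 := he.symm u v
  refine ⟨?_, ?_⟩
  · simp only [map_add, LinearMap.add_apply]
    linarith [hu.1, hv.1]
  · rw [map_add]
    exact add_pos hu.2 hv.2

lemma IsFutureCausal.smul {t u : V} (hu : IsFutureCausal g t u) {c : ℝ} (hc : 0 < c) :
    IsFutureCausal g t (c • u) := by
  refine ⟨?_, ?_⟩
  · simp only [map_smul, LinearMap.smul_apply, smul_eq_mul]
    exact mul_nonneg hc.le (mul_nonneg hc.le hu.1)
  · simp only [map_smul, smul_eq_mul]
    exact mul_pos hc hu.2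

/-- A linear form that is non-negative on the future cone and vanishes on a vector of this cone is
a multiple of the metrically equivalent form of this vector. -/
lemma IsFrame.eq_smul_of_nonneg (he : IsFrame g e) {u : V} (hu : IsFutureCausal g (e 0) u)
    (q : V →ₗ[ℝ] ℝ) (hq : ∀ v, IsFutureCausal g (e 0) v → 0 ≤ q v) (hqu : q u = 0) :
    ∃ c : ℝ, ∀ x, q x = c * g u x := by
  have ht : g (e 0) (e 0) = 1 := by rw [he]; simp [sig]
  -- For any `ε > 0` and large `A`, the vector `A • u + x + ε • e 0` is future causal, while `q`
  -- does not see `A • u`. Letting `ε` tend to zero gives the claim; applied to `-x` it yields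
  -- equality.
  have h1 : ∀ x, g u x = 0 → 0 ≤ q x := by
    intro x hx
    refine le_of_forall_pos_le_add fun δ hδ => ?_
    obtain ⟨ε, hε, hεδ⟩ : ∃ ε > 0, ε * q (e 0) ≤ δ := by
      have h0 : 0 ≤ q (e 0) := hq _ ⟨by rw [ht]; norm_num, by rw [ht]; norm_num⟩
      refine ⟨δ / (q (e 0) + 1), by positivity, ?_⟩
      rw [div_mul_eq_mul_div, div_le_iff₀ (by positivity)]
      nlinarith
    obtain ⟨A, hA, hA1, hA2⟩ : ∃ A : ℝ, 0 ≤ A ∧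
        0 ≤ g x x + 2 * A * ε * g (e 0) u + 2 * ε * g (e 0) x + ε ^ 2 ∧
        0 < A * g (e 0) u + g (e 0) x + ε := by
      have hp := hu.2
      have e1 := Filter.tendsto_id.atTop_mul_const (r := g (e 0) u) hp
      have e2 := Filter.tendsto_id.atTop_mul_const (r := 2 * ε * g (e 0) u) (by positivity)
      obtain ⟨A, a1, a2, a3⟩ := ((Filter.eventually_ge_atTop 0).and
        ((e1.eventually_gt_atTop (-(g (e 0) x + ε))).and
        (e2.eventually_ge_atTop (-(g x x + 2 * ε * g (e 0) x + ε ^ 2))))).exists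
      simp only [id] at a2 a3
      exact ⟨A, a1, by linarith, by linarith⟩
    have h2 := hq (A • u + x + ε • e 0) ⟨?_, ?_⟩
    · simp only [map_add, map_smul, hqu, smul_eq_mul] at h2
      linarith
    · simp only [map_add, map_smul, LinearMap.add_apply, LinearMap.smul_apply, smul_eq_mul, ht,
        he.symm x u, he.symm u (e 0), he.symm x (e 0), hx]
      have := mul_nonneg (mul_nonneg hA hA) hu.1
      linarith
    · simp only [map_add, map_smul, smul_eq_mul, ht]
      linarith
  have h2 : ∀ x, g u x = 0 → q x = 0 := fun x hx => by
    have a := h1 x hx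
    have b := h1 (-x) (by simp [hx])
    rw [map_neg] at b
    linarith
  have hut : g u (e 0) ≠ 0 := by rw [he.symm]; exact hu.2.ne'
  refine ⟨q (e 0) / g u (e 0), fun x => ?_⟩
  have h3 := h2 (x - (g u x / g u (e 0)) • e 0) (by
    rw [map_sub, map_smul, smul_eq_mul, div_mul_cancel₀ _ hut, sub_self])
  rw [map_sub, map_smul, smul_eq_mul, sub_eq_zero] at h3
  rw [h3]
  ring

/-- A symmetric tensor that is non-negative on the future cone has a causal eigenvector. -/
lemma IsFrame.exists_causal_eigenvector (he : IsFrame g e) (S : LinearMap.BilinForm ℝ V)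
    (hS : ∀ x y, S x y = S y x) (hdom : ∀ u, IsFutureCausal g (e 0) u → 0 ≤ S u u) :
    ∃ (u : V) (μ : ℝ), IsFutureCausal g (e 0) u ∧ ∀ x, S x u = μ * g x u := by
  have ht : g (e 0) (e 0) = 1 := by rw [he]; simp [sig]
  -- The supremum of `Λ` is the largest `l` for which `S - l g` is non-negative on the cone.
  let Λ : Set ℝ := {l | ∀ u, IsFutureCausal g (e 0) u → l * g u u ≤ S u u}
  have hΛ0 : (0 : ℝ) ∈ Λ := fun u hu => by simpa using hdom u hu
  have hΛb : BddAbove Λ := ⟨S (e 0) (e 0), fun l hl => by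
    simpa [ht] using hl (e 0) ⟨by rw [ht]; norm_num, by rw [ht]; norm_num⟩⟩
  have hmem : sSup Λ ∈ Λ := fun u hu => by
    rcases hu.1.eq_or_lt with h | h
    · rw [← h, mul_zero]; exact hdom u hu
    · rw [← le_div_iff₀ h]
      exact csSup_le ⟨0, hΛ0⟩ fun l hl => (le_div_iff₀ h).2 (hl u hu)
  set l := sSup Λ
  -- If the form were positive on the whole cone, it would have a minimum `m > 0` on the compact
  -- slice of time component `1`. There `g ≤ 1`, so by homogeneity `l + m` would belong to `Λ`.
  obtain ⟨u, hu, hQ⟩ : ∃ u, IsFutureCausal g (e 0) u ∧ S u u = l * g u u := by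
    by_contra! hne
    let φ : (Fin n → ℝ) → V := fun z => e 0 + ∑ j, z j • e j.succ
    let K : Set (Fin n → ℝ) := {z | ∑ j, z j ^ 2 ≤ 1}
    have hφt : ∀ z, g (e 0) (φ z) = 1 := fun z => by
      simp [φ, ht, he _ _, (Fin.succ_ne_zero _).symm]
    have hφj : ∀ z j, g (e j.succ) (φ z) = - z j := fun z j => by
      simp [φ, he _ _, Fin.succ_ne_zero, sig]
    have hφg : ∀ z, g (φ z) (φ z) = 1 - ∑ j, z j ^ 2 := fun z => by
      rw [he.apply_eq_sub, hφt]
      simp [hφj, sq]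
    have hK : IsCompact K := by
      refine Metric.isCompact_of_isClosed_isBounded
        (isClosed_le (by fun_prop) continuous_const) ?_
      refine (Metric.isBounded_closedBall (x := (0 : Fin n → ℝ)) (r := 1)).subset fun z hz => ?_
      rw [mem_closedBall_zero_iff, pi_norm_le_iff_of_nonneg zero_le_one]
      intro j
      rw [Real.norm_eq_abs, ← sq_le_one_iff_abs_le_one]
      exact (single_le_sum (f := fun j => z j ^ 2) (fun _ _ => sq_nonneg _) (mem_univ j)).trans hz
    have hcont : ContinuousOn (fun z => S (φ z) (φ z) - l * g (φ z) (φ z)) K := by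
      refine Continuous.continuousOn ?_
      simp only [φ, map_add, map_sum, map_smul, LinearMap.add_apply, LinearMap.sum_apply,
        LinearMap.smul_apply, smul_eq_mul]
      fun_prop
    obtain ⟨z, hz, hmin⟩ := hK.exists_isMinOn ⟨0, by simp [K]⟩ hcont
    have hfut : ∀ z ∈ K, IsFutureCausal g (e 0) (φ z) := fun z hz =>
      ⟨by rw [hφg]; linarith [show ∑ j, z j ^ 2 ≤ 1 from hz], by rw [hφt]; norm_num⟩
    set m := S (φ z) (φ z) - l * g (φ z) (φ z)
    have hm : 0 < m := by
      have h1 := hmem _ (hfut z hz)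
      exact sub_pos.2 (lt_of_le_of_ne h1 (hne _ (hfut z hz)).symm)
    have hlm : l + m ∈ Λ := by
      intro u hu
      obtain ⟨z', c, hc, rfl⟩ : ∃ (z' : Fin n → ℝ) (c : ℝ), 0 < c ∧ u = c • φ z' := by
        refine ⟨fun j => - g (e j.succ) u / g (e 0) u, g (e 0) u, hu.2, ?_⟩
        have hp := hu.2.ne'
        simp only [φ, smul_add, smul_sum, smul_smul, mul_div_cancel₀ _ hp]
        conv_lhs => rw [← he.sum_raised u, Fin.sum_univ_succ]
        simp [raised, sig, he.symm u]
      clear_value φ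
      simp only [map_smul, LinearMap.smul_apply, smul_eq_mul]
      have h1 := hu.1
      simp only [map_smul, LinearMap.smul_apply, smul_eq_mul] at h1
      have h2 : 0 ≤ g (φ z') (φ z') := nonneg_of_mul_nonneg_right
        (nonneg_of_mul_nonneg_right h1 hc) hc
      have hz'K : z' ∈ K := by
        rw [hφg] at h2
        exact sub_nonneg.1 h2
      have h5 : m ≤ S (φ z') (φ z') - l * g (φ z') (φ z') := hmin hz'K
      have h6 : g (φ z') (φ z') ≤ 1 := by
        rw [hφg]; linarith [sum_nonneg fun (j : Fin n) (_ : j ∈ univ) => sq_nonneg (z' j)]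
      have h7 : (l + m) * g (φ z') (φ z') ≤ S (φ z') (φ z') := by nlinarith
      have h8 := mul_le_mul_of_nonneg_left h7 (mul_self_nonneg c)
      linarith
    linarith [le_csSup hΛb hlm]
  let Q : LinearMap.BilinForm ℝ V := S - l • g
  have hQ' : ∀ x y, Q x y = S x y - l * g x y := fun _ _ => rfl
  have hQ0 : ∀ v, IsFutureCausal g (e 0) v → 0 ≤ Q v v := fun v hv => by
    rw [hQ']; linarith [hmem v hv]
  -- First variation at the zero `u` of `Q`: dividing `Q (u + s v) (u + s v) ≥ 0` by small `s > 0`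
  -- gives `Q u v ≥ 0` for every future causal `v`.
  obtain ⟨c, hc⟩ := he.eq_smul_of_nonneg hu (Q u) (fun v hv => by
    by_contra! hneg
    have h1 : ∀ s : ℝ, 0 < s → 0 ≤ 2 * Q u v + s * Q v v := fun s hs => by
      have h2 := hQ0 _ (he.future_add hu (hv.smul hs))
      have h3 : Q v u = Q u v := by rw [hQ', hQ', hS, he.symm]
      simp only [map_add, map_smul, LinearMap.add_apply, LinearMap.smul_apply, smul_eq_mul, h3,
        hQ' u u, hQ, sub_self] at h2
      by_contra! h4
      nlinarith
    have h5 := hQ0 v hv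
    have h6 := h1 (-Q u v / (Q v v + 1)) (by apply div_pos <;> linarith)
    have h7 : -Q u v / (Q v v + 1) * Q v v ≤ -Q u v := by
      rw [div_mul_eq_mul_div, div_le_iff₀ (by linarith)]
      nlinarith
    linarith) (by rw [hQ', hQ, sub_self])
  refine ⟨u, l + c, hu, fun x => ?_⟩
  have := hc x
  rw [hQ', hS, he.symm u] at this
  linarith

/-- Orthonormal vectors, the first of which is timelike, can be completed to a frame that
diagonalizes a given symmetric tensor on their orthogonal complement. -/
lemma IsFrame.exists_frame_diagonal {e : Module.Basis (Fin N) ℝ V} (he : IsFrame g e)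
    (S : LinearMap.BilinForm ℝ V) (hS : ∀ x y, S x y = S y x) {s : ℕ} (hs : s + 1 ≤ N)
    (v : Fin (s + 1) → V) (hv : ∀ i j, g (v i) (v j) = if i = j then sig i else 0) :
    ∃ (f : Module.Basis (Fin N) ℝ V) (ρ : Fin N → ℝ), IsFrame g f ∧
      (∀ i : Fin (s + 1), f (Fin.castLE hs i) = v i) ∧
      (∀ i j, s + 1 ≤ i.val → i ≤ j → ρ j ≤ ρ i) ∧
      ∀ i j : Fin N, s + 1 ≤ i.val → s + 1 ≤ j.val →
        S (f i) (f j) = if i = j then -ρ i else 0 := by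
  obtain ⟨r, rfl⟩ : ∃ r, N = s + 1 + r := ⟨N - (s + 1), by omega⟩
  have : FiniteDimensional ℝ V := e.finiteDimensional_of_finite
  have hN : Module.finrank ℝ V = s + 1 + r := by simp [Module.finrank_eq_card_basis e]
  have hnd : g.Nondegenerate := by
    have key : ∀ x, (∀ y, g x y = 0) → x = 0 := fun x hx => by
      rw [← he.sum_raised x]; simp [hx]
    exact ⟨key, fun x hx => key x fun y => by rw [he.symm, hx]⟩
  have hli : LinearIndependent ℝ v := by
    rw [Fintype.linearIndependent_iff]
    intro c hc i
    have h1 : g (v i) (∑ j, c j • v j) = 0 := by rw [hc, map_zero]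
    simp only [map_sum, map_smul, hv, smul_eq_mul, mul_ite, mul_zero, sum_ite_eq, mem_univ,
      if_true] at h1
    have := sig_mul_self i
    exact (mul_eq_zero.1 h1).resolve_right fun h => by simp [h] at this
  let U := g.orthogonal (Submodule.span ℝ (Set.range v))
  have hUv : ∀ x ∈ U, ∀ i, g (v i) x = 0 := fun x hx i =>
    hx (v i) (Submodule.subset_span ⟨i, rfl⟩)
  have hU : Module.finrank ℝ U = r := by
    rw [LinearMap.BilinForm.finrank_orthogonal hnd, finrank_span_eq_card hli, hN]
    simp
  obtain ⟨w, ρ, hw, hρ, hgw, hSw⟩ := exists_diagonal_of_negDef S he.symm hS U (fun x hx hx0 => by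
    by_contra! h
    have h0 := hUv x hx 0
    exact hx0 (he.eq_zero_of_orthogonal' (by rw [hv]; simp [sig]) h0 h)) hU
  obtain ⟨f, hf, hff⟩ := exists_frame_of_orthonormal (g := g) hN (Fin.append v w) (fun i j => by
    refine Fin.addCases (fun i => ?_) (fun i => ?_) i <;>
      refine Fin.addCases (fun j => ?_) (fun j => ?_) j
    · simp [hv, sig]
    · rw [Fin.append_left, Fin.append_right, hUv _ (hw j), if_neg]
      exact fun h => absurd (congrArg Fin.val h) (by simp; omega)
    · rw [Fin.append_left, Fin.append_right, he.symm, hUv _ (hw i), if_neg]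
      exact fun h => absurd (congrArg Fin.val h) (by simp; omega)
    · simp [hgw, sig])
  have hval : ∀ i : Fin (s + 1 + r), s + 1 ≤ i.val → ∃ l : Fin r, i = Fin.natAdd (s + 1) l :=
    fun i hi => ⟨⟨i.val - (s + 1), by omega⟩, Fin.ext (by simp; omega)⟩
  -- The zeros are placeholders: nothing is claimed about the values at the first `s + 1` indices.
  refine ⟨f, Fin.append (fun _ => 0) ρ, hff, fun i => ?_, fun i j hi hij => ?_,
    fun i j hi hj => ?_⟩
  · rw [hf]
    exact Fin.append_left v w i
  · obtain ⟨i, rfl⟩ := hval i hi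
    obtain ⟨j, rfl⟩ := hval j (hi.trans hij)
    simp only [Fin.append_right]
    exact hρ (by simpa using hij)
  · obtain ⟨i, rfl⟩ := hval i hi
    obtain ⟨j, rfl⟩ := hval j hj
    simp [hf, hSw]

/-- The normal form of a symmetric tensor from an orthonormal family of vectors on which its action
is known. -/
lemma IsFrame.exists_normal_form_of_family {e : Module.Basis (Fin N) ℝ V} (he : IsFrame g e)
    (S : LinearMap.BilinForm ℝ V) (hS : ∀ x y, S x y = S y x) {s : ℕ} (hs : s + 1 ≤ N)
    (v : Fin (s + 1) → V) (hv : ∀ i j, g (v i) (v j) = if i = j then sig i else 0)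
    {l β : ℝ} {k : V} (hvS : ∀ i x, S x (v i) = l * g x (v i) + β * (g k x * g k (v i)))
    (hk : ∀ x, (∀ i, g (v i) x = 0) → g k x = 0)
    (hb : ∀ x, (∀ i, g (v i) x = 0) → l * g x x ≤ S x x ∧ S x x ≤ -l * g x x) (hl : 0 ≤ l) :
    ∃ (f : Module.Basis (Fin N) ℝ V) (ρ : Fin N → ℝ), IsFrame g f ∧
      (∀ i : Fin (s + 1), f (Fin.castLE hs i) = v i) ∧ Antitone ρ ∧ (∀ i, -l ≤ ρ i) ∧
      (∀ i : Fin N, i.val < s + 1 → ρ i = l) ∧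
      ∀ i j, S (f i) (f j) = ρ i * g (f i) (f j) + β * (g k (f i) * g k (f j)) := by
  obtain ⟨f, ρ, hf, hfv, hρ, hSf⟩ := he.exists_frame_diagonal S hS hs v hv
  have hfv' : ∀ i : Fin N, ∀ h : i.val < s + 1, f i = v ⟨i, h⟩ := fun i h => by
    rw [← hfv]; rfl
  have hort : ∀ i : Fin N, s + 1 ≤ i.val → ∀ j, g (v j) (f i) = 0 := fun i hi j => by
    rw [← hfv, hf, if_neg]
    exact fun h => absurd (congrArg Fin.val h) (by simp; omega)
  have hbd : ∀ i : Fin N, s + 1 ≤ i.val → ρ i ≤ l ∧ -l ≤ ρ i := fun i hi => by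
    have h1 := hb (f i) (hort i hi)
    have h2 : g (f i) (f i) = -1 := by
      rw [hf, if_pos rfl, sig, if_neg (by omega)]
    rw [hSf i i hi hi, if_pos rfl, h2] at h1
    constructor <;> linarith [h1.1, h1.2]
  refine ⟨f, fun i => if i.val < s + 1 then l else ρ i, hf, hfv, fun i j hij => ?_, fun i => ?_,
    fun i hi => if_pos hi, fun i j => ?_⟩
  · have hij' : i.val ≤ j.val := hij
    dsimp only
    split_ifs with h1 h2
    · exact le_rfl
    · omega
    · exact (hbd j (by omega)).1
    · exact hρ i j (by omega) hij
  · dsimp only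
    split_ifs with h1
    · linarith
    · exact (hbd i (by omega)).2
  · dsimp only
    by_cases hj : j.val < s + 1
    · rw [hfv' j hj, hvS, ← hfv' j hj]
      split_ifs with hi
      · rfl
      · rw [hfv' j hj, he.symm, hort i (by omega)]
        ring
    · by_cases hi : i.val < s + 1
      · rw [if_pos hi, hS, hfv' i hi, hvS, he.symm, hk (f j) (hort j (by omega))]
        ring
      · rw [if_neg hi, hSf i j (by omega) (by omega), hk (f j) (hort j (by omega)), hf]
        split_ifs with h
        · rw [sig, if_neg (by omega)]; ring
        · ring

end Cone

end Spectral

/-! ### Normal forms of dominant tensors -/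

section NormalForms

variable {V : Type*} [AddCommGroup V] [Module ℝ V] {N : ℕ} {g : LinearMap.BilinForm ℝ V}

/-- For large `a` the term `a ^ 2 * D` decides the sign; this extracts bounds from families of
causal vectors. -/
lemma nonneg_of_forall_add_sq {C D : ℝ} (h : ∀ a : ℝ, 0 ≤ C + a ^ 2 * D) : 0 ≤ D := by
  by_contra! hD
  have h1 := h (Real.sqrt ((|C| + 1) / -D))
  have h2 : 0 ≤ (|C| + 1) / -D := div_nonneg (by positivity) (by linarith)
  rw [Real.sq_sqrt h2, div_mul_eq_mul_div, div_neg, mul_div_cancel_right₀ _ hD.ne] at h1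
  linarith [le_abs_self C]

/-- A linear form that vanishes on the left kernel of a bilinear form is represented by it. -/
lemma exists_apply_eq_of_ker [FiniteDimensional ℝ V] (B : LinearMap.BilinForm ℝ V)
    (φ : Module.Dual ℝ V) (h : ∀ x, (∀ y, B x y = 0) → φ x = 0) :
    ∃ u, ∀ y, B y u = φ y := by
  have h1 : φ ∈ LinearMap.range (LinearMap.dualMap B) := by
    rw [LinearMap.range_dualMap_eq_dualAnnihilator_ker, Submodule.mem_dualAnnihilator]
    intro x hx
    exact h x fun y => by rw [LinearMap.mem_ker.1 hx]; rfl
  obtain ⟨ψ, hψ⟩ := h1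
  obtain ⟨u, rfl⟩ := (Module.evalEquiv ℝ V).surjective ψ
  exact ⟨u, fun y => by rw [← hψ]; rfl⟩

variable {n : ℕ} {e : Module.Basis (Fin (n + 2)) ℝ V}

/-- A dominant tensor with a timelike eigenvector is diagonalizable in a frame, and the eigenvalue
of the timelike vector dominates the others. -/
lemma IsFrame.exists_normal_form_of_timelike (he : IsFrame g e) (S : LinearMap.BilinForm ℝ V)
    (hS : ∀ x y, S x y = S y x) (hdom : Dominant g (e 0) S) {u : V} {l : ℝ} (hu : 0 < g u u)
    (hul : ∀ x, S x u = l * g x u) :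
    ∃ (f : Module.Basis (Fin (n + 2)) ℝ V) (ρ : Fin (n + 2) → ℝ), IsFrame g f ∧ Antitone ρ ∧
      (∀ i, -ρ 0 ≤ ρ i) ∧ ∀ i j, S (f i) (f j) = ρ i * g (f i) (f j) := by
  have ht : g (e 0) (e 0) = 1 := by rw [he]; simp [sig]
  obtain ⟨v, hv, hvt, hvl⟩ : ∃ v, g v v = 1 ∧ 0 < g (e 0) v ∧ ∀ x, S x v = l * g x v := by
    have h1 : g (e 0) u ≠ 0 := fun h => by
      have := he.eq_zero_of_orthogonal (u := e 0) (by rw [ht]; norm_num) h hu.le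
      simp [this] at hu
    have h2 : ∃ c : ℝ, 0 < c * g (e 0) u ∧ c * c * g u u = 1 := by
      have h3 : 0 < Real.sqrt (g u u) := Real.sqrt_pos.2 hu
      have h4 := Real.mul_self_sqrt hu.le
      have h5 : (Real.sqrt (g u u))⁻¹ * (Real.sqrt (g u u))⁻¹ * g u u = 1 := by
        rw [← mul_inv, h4, inv_mul_cancel₀ hu.ne']
      rcases h1.lt_or_gt with h | h
      · exact ⟨-(Real.sqrt (g u u))⁻¹, by
          have := mul_neg_of_pos_of_neg (inv_pos.2 h3) h
          linarith, by rw [neg_mul_neg, h5]⟩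
      · exact ⟨(Real.sqrt (g u u))⁻¹, mul_pos (inv_pos.2 h3) h, h5⟩
    obtain ⟨c, hc, hcc⟩ := h2
    refine ⟨c • u, ?_, ?_, fun x => ?_⟩
    · simpa [mul_assoc] using hcc
    · simpa using hc
    · simp only [map_smul, hul, smul_eq_mul]; ring
  have hvf : IsFutureCausal g (e 0) v := ⟨by rw [hv]; norm_num, hvt⟩
  have hl : 0 ≤ l := by
    have := hdom v v hvf hvf
    rwa [hvl, hv, mul_one] at this
  obtain ⟨f, ρ, hf, -, hρ, hρl, hρ0, hSf⟩ := he.exists_normal_form_of_family S hS (s := 0)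
    (by omega) (fun _ => v) (fun i j => by
      rw [if_pos (Subsingleton.elim (α := Fin 1) i j), hv]; simp [sig]) (l := l) (β := 0) (k := 0)
    (fun i x => by rw [hvl]; ring) (fun x _ => by simp) (fun x hx => by
      have hx := hx 0
      rcases eq_or_ne x 0 with rfl | hx0
      · simp
      have hxx : g x x < 0 := by
        by_contra! h
        exact hx0 (he.eq_zero_of_orthogonal (by rw [hv]; norm_num) hx h)
      -- With this `q` the vectors `q • v + x` and `q • v - x` are null. Dominance on the first with
      -- itself gives the lower bound, on the two together the upper bound.
      obtain ⟨q, hq, hqq⟩ : ∃ q : ℝ, 0 < q ∧ q * q = -g x x :=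
        ⟨Real.sqrt (-g x x), Real.sqrt_pos.2 (by linarith), Real.mul_self_sqrt (by linarith)⟩
      have hfut : ∀ y, g v y = 0 → g y y = g x x → IsFutureCausal g (e 0) (q • v + y) := by
        intro y hy hyy
        refine he.future_of_pos hvf ?_ ?_
        · simp only [map_add, map_smul, LinearMap.add_apply, LinearMap.smul_apply, smul_eq_mul, hv,
            hy, he.symm y v, hyy]
          linarith
        · simp only [map_add, map_smul, smul_eq_mul, hv, hy]
          linarith
      have hp := hfut x hx rfl
      have hm := hfut (-x) (by simp [hx]) (by simp)
      have h1 := hdom _ _ hp hp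
      have h2 := hdom _ _ hp hm
      simp only [map_add, map_smul, map_neg, LinearMap.add_apply, LinearMap.smul_apply, smul_eq_mul,
        hvl, hv, hS v x, he.symm x v, hx] at h1 h2
      have h3 : q * (q * (l * 1)) = l * -g x x := by rw [← hqq]; ring
      constructor <;> linarith) hl
  have h0 : ρ 0 = l := hρ0 0 (by simp)
  exact ⟨f, ρ, hf, hρ, fun i => h0 ▸ hρl i, fun i j => by rw [hSf]; ring⟩

/-- A dominant tensor with a null eigenvector but no timelike eigenvector is the sum of a
diagonalizable tensor and the square of the null eigenvector. -/
lemma IsFrame.exists_normal_form_of_null (he : IsFrame g e) (S : LinearMap.BilinForm ℝ V)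
    (hS : ∀ x y, S x y = S y x) (hdom : Dominant g (e 0) S) {k : V} {l : ℝ}
    (hk : IsFutureCausal g (e 0) k) (hkk : g k k = 0) (hkl : ∀ x, S x k = l * g x k)
    (hno : ∀ u, 0 < g u u → ¬ ∀ x, S x u = l * g x u) :
    ∃ (f : Module.Basis (Fin (n + 2)) ℝ V) (ρ : Fin (n + 2) → ℝ) (β : ℝ), IsFrame g f ∧
      Antitone ρ ∧ (∀ i, -ρ 0 ≤ ρ i) ∧ 0 < β ∧ ρ 1 = ρ 0 ∧
      ∀ i j, S (f i) (f j) =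
        ρ i * g (f i) (f j) + β * (g (f 0 + f 1) (f i) * g (f 0 + f 1) (f j)) := by
  have : FiniteDimensional ℝ V := e.finiteDimensional_of_finite
  have ht : g (e 0) (e 0) = 1 := by rw [he]; simp [sig]
  have htf : IsFutureCausal g (e 0) (e 0) := ⟨by rw [ht]; norm_num, by rw [ht]; norm_num⟩
  have hkt : 0 < g k (e 0) := by rw [he.symm]; exact hk.2
  have hl : 0 ≤ l := by
    have h1 := hdom _ _ htf hk
    rw [hkl] at h1
    exact nonneg_of_mul_nonneg_left h1 hk.2
  -- Otherwise a suitable `s` gives the eigenvector `s • k + x` norm `1`, and a timelike eigenvector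
  -- is excluded.
  have hker : ∀ x, (∀ y, S y x = l * g y x) → g k x = 0 := by
    intro x hx
    by_contra hne
    obtain ⟨s, hs⟩ : ∃ s : ℝ, 2 * s * g k x = 1 - g x x :=
      ⟨(1 - g x x) / (2 * g k x), by field_simp⟩
    refine hno (s • k + x) ?_ fun y => ?_
    · simp only [map_add, map_smul, LinearMap.add_apply, LinearMap.smul_apply, smul_eq_mul, hkk,
        he.symm x k]
      linarith
    · simp only [map_add, map_smul, smul_eq_mul, hkl, hx]
      ring
  -- Fredholm alternative: `g k` vanishes on the kernel of `S - l g`, so it lies in its range.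
  obtain ⟨u, hu⟩ := exists_apply_eq_of_ker (S - l • g) (g k) (fun x hx => hker x fun y => by
      have := hx y
      simp only [LinearMap.sub_apply, LinearMap.smul_apply, smul_eq_mul] at this
      rw [hS, he.symm]
      linarith)
  have hu' : ∀ y, S y u = l * g y u + g k y := fun y => by
    have := hu y
    simp only [LinearMap.sub_apply, LinearMap.smul_apply, smul_eq_mul] at this
    linarith
  -- If not, `S - l g` is negative at `w = e 0 + a • u` for very negative `a`. Adding a multiple of
  -- `k` makes `w` null and future-pointing without changing that value, which contradicts
  -- dominance.
  have hku : 0 < g k u := by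
    by_contra! hneg
    obtain ⟨a, ha, ha2⟩ : ∃ a : ℝ, a ≤ 0 ∧ S (e 0) (e 0) - l * g (e 0) (e 0) +
        2 * a * g k (e 0) < 0 := by
      generalize S (e 0) (e 0) - l * g (e 0) (e 0) = C
      refine ⟨-((|C| + 1) / (2 * g k (e 0))), neg_nonpos.2 (by positivity), ?_⟩
      field_simp
      linarith [le_abs_self C]
    have hw : 0 < g k (e 0 + a • u) := by
      simp only [map_add, map_smul, smul_eq_mul]
      nlinarith
    obtain ⟨w, hwd⟩ : ∃ w, w = e 0 + a • u := ⟨_, rfl⟩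
    rw [← hwd] at hw
    have hSw : S w w - l * g w w = S (e 0) (e 0) - l * g (e 0) (e 0) + 2 * a * g k (e 0) +
        a * a * g k u := by
      rw [hwd]
      simp only [map_add, map_smul, LinearMap.add_apply, LinearMap.smul_apply, smul_eq_mul, hu',
        hS u (e 0), he.symm u (e 0)]
      ring
    obtain ⟨b, hb⟩ : ∃ b : ℝ, 2 * b * g k w = - g w w :=
      ⟨-g w w / (2 * g k w), by field_simp⟩
    have hz : g (w + b • k) (w + b • k) = 0 := by
      simp only [map_add, map_smul, LinearMap.add_apply, LinearMap.smul_apply, smul_eq_mul, hkk,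
        he.symm w k]
      linarith
    have hfz : IsFutureCausal g (e 0) (w + b • k) := by
      refine he.future_of_pos hk hz.ge ?_
      simp only [map_add, map_smul, smul_eq_mul, hkk]
      linarith
    have h1 := hdom _ _ hfz hfz
    simp only [map_add, map_smul, LinearMap.add_apply, LinearMap.smul_apply, smul_eq_mul, hkk,
      hkl, hS k w, he.symm w k] at h1
    have h2 : a * a * g k u ≤ 0 := mul_nonpos_of_nonneg_of_nonpos (mul_self_nonneg a) hneg
    have h3 : b * (l * g k w) + b * (l * g k w) = - l * g w w := by
      linear_combination l * hb
    linarith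
  obtain ⟨v, hvv, hkv, hvS⟩ : ∃ v, g v v = 1 ∧ 0 < g k v ∧
      ∃ γ : ℝ, 0 < γ ∧ ∀ y, S y v = l * g y v + γ * g k y := by
    obtain ⟨z, hz, hkz, hzS⟩ : ∃ z, 0 < g z z ∧ 0 < g k z ∧ ∀ y, S y z = l * g y z + g k y := by
      obtain ⟨s, hs⟩ : ∃ s : ℝ, 2 * s * g k u = 1 - g u u :=
        ⟨(1 - g u u) / (2 * g k u), by field_simp⟩
      refine ⟨s • k + u, ?_, ?_, fun y => ?_⟩
      · simp only [map_add, map_smul, LinearMap.add_apply, LinearMap.smul_apply, smul_eq_mul, hkk,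
          he.symm u k]
        linarith
      · simpa [hkk] using hku
      · simp only [map_add, map_smul, smul_eq_mul, hkl, hu']
        ring
    have h3 : 0 < (Real.sqrt (g z z))⁻¹ := inv_pos.2 (Real.sqrt_pos.2 hz)
    have h4 := Real.mul_self_sqrt hz.le
    refine ⟨(Real.sqrt (g z z))⁻¹ • z, ?_, ?_, (Real.sqrt (g z z))⁻¹, h3, fun y => ?_⟩
    · simp only [map_smul, LinearMap.smul_apply, smul_eq_mul]
      rw [← mul_assoc, ← mul_inv, h4, inv_mul_cancel₀ hz.ne']
    · simpa using mul_pos h3 hkz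
    · simp only [map_smul, smul_eq_mul, hzS]
      ring
  obtain ⟨γ, hγ, hvS⟩ := hvS
  -- With `g m v = 1`, the vectors `v` and `m - v` are orthonormal of signature `(+, -)`, and their
  -- sum is the null vector `m`.
  obtain ⟨m, hm⟩ : ∃ m, m = (g k v)⁻¹ • k := ⟨_, rfl⟩
  have hmv : g m v = 1 := by
    rw [hm]; simp [inv_mul_cancel₀ hkv.ne']
  have hmm : g m m = 0 := by rw [hm]; simp [hkk]
  have hkm : ∀ x, g k x = g k v * g m x := fun x => by
    rw [hm]; simp [mul_inv_cancel_left₀ hkv.ne']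
  have hml : ∀ x, S x m = l * g x m := fun x => by
    rw [hm]; simp only [map_smul, smul_eq_mul, hkl]; ring
  have hvf : IsFutureCausal g (e 0) v := he.future_of_pos hk (by rw [hvv]; norm_num) hkv
  have hvS' : ∀ y, S y v = l * g y v + γ * g k v * g m y := fun y => by
    rw [hvS, hkm]; ring
  set β := γ * g k v with hβ
  have hβ0 : 0 < β := mul_pos hγ hkv
  obtain ⟨f, ρ, hf, hfv, hρ, hρl, hρ0, hSf⟩ := he.exists_normal_form_of_family S hS (s := 1)
    (by omega) ![v, m - v] (fun i j => by
      fin_cases i <;> fin_cases j <;> simp [sig, hvv, hmv, hmm, he.symm v m]) (l := l) (β := β)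
    (k := m)
    (fun i x => by
      fin_cases i
      · simp [hvS', hmv]
      · simp [hvS', hml, hmv, hmm]
        ring) (fun x hx => by
      have h0 := hx 0
      have h1 := hx 1
      simp only [Matrix.cons_val_zero, Matrix.cons_val_one, map_sub, LinearMap.sub_apply] at h0 h1
      linarith) (fun x hx => by
      have h0 := hx 0
      have h1 := hx 1
      simp only [Matrix.cons_val_zero, Matrix.cons_val_one, map_sub, LinearMap.sub_apply] at h0 h1
      have hmx : g m x = 0 := by linarith
      have hxx : g x x ≤ 0 := by
        by_contra! h
        have := he.eq_zero_of_orthogonal (by rw [hvv]; norm_num) h0 h.le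
        simp [this] at h
      -- These are images of `v` under null rotations fixing `m`, so they have norm `1`. As `a`
      -- grows, dominance on them isolates `S x x` against `l * g x x`.
      have hfut : ∀ a : ℝ,
          IsFutureCausal g (e 0) (v + a • x + (-(a ^ 2 * g x x) / 2) • m) := by
        intro a
        refine he.future_of_pos hvf ?_ ?_
        · simp only [map_add, map_smul, LinearMap.add_apply, LinearMap.smul_apply, smul_eq_mul,
            hvv, h0, hmx, hmv, hmm, he.symm v m, he.symm x m, he.symm x v]
          nlinarith
        · simp only [map_add, map_smul, smul_eq_mul, hvv, h0, he.symm v m, hmv]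
          nlinarith [mul_nonneg (sq_nonneg a) (neg_nonneg.2 hxx)]
      constructor
      · have : 0 ≤ S x x - l * g x x := nonneg_of_forall_add_sq (C := l + β) fun a => by
          have h := hdom _ _ (hfut a) (hfut a)
          simp only [map_add, map_smul, LinearMap.add_apply, LinearMap.smul_apply, smul_eq_mul,
            hvS', hml, hS v x, hS m x, hvv, h0, hmx, hmv, hmm, he.symm v m, he.symm x m,
            he.symm x v] at h
          linarith
        linarith
      · have : 0 ≤ -l * g x x - S x x := nonneg_of_forall_add_sq (C := l + β) fun a => by
          have h := hdom _ _ (hfut a) (hfut (-a))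
          simp only [map_add, map_smul, LinearMap.add_apply, LinearMap.smul_apply, smul_eq_mul,
            hvS', hml, hS v x, hS m x, hvv, h0, hmx, hmv, hmm, he.symm v m, he.symm x m,
            he.symm x v] at h
          linarith
        linarith) hl
  have h0 : ρ 0 = l := hρ0 0 (by simp)
  have h1 : ρ 1 = l := hρ0 1 (by simp)
  have hf0 : f 0 = v := hfv 0
  have hf1 : f 1 = m - v := hfv 1
  refine ⟨f, ρ, β, hf, hρ, fun i => h0 ▸ hρl i, hβ0, by rw [h0, h1], fun i j => ?_⟩
  rw [hSf]
  congr 3 <;> rw [hf0, hf1, add_sub_cancel]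

/-- The normal form of a dominant tensor. -/
theorem IsFrame.exists_normal_form (he : IsFrame g e) (S : LinearMap.BilinForm ℝ V)
    (hS : ∀ x y, S x y = S y x) (hdom : Dominant g (e 0) S) :
    ∃ (f : Module.Basis (Fin (n + 2)) ℝ V) (ρ : Fin (n + 2) → ℝ) (β : ℝ), IsFrame g f ∧
      Antitone ρ ∧ (∀ i, -ρ 0 ≤ ρ i) ∧ 0 ≤ β ∧ (β ≠ 0 → ρ 1 = ρ 0) ∧
      ∀ i j, S (f i) (f j) =
        ρ i * g (f i) (f j) + β * (g (f 0 + f 1) (f i) * g (f 0 + f 1) (f j)) := by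
  by_cases htl : ∃ (u : V) (l : ℝ), 0 < g u u ∧ ∀ x, S x u = l * g x u
  · obtain ⟨u, l, hu, hul⟩ := htl
    obtain ⟨f, ρ, hf, hρ, hρ0, hSf⟩ := he.exists_normal_form_of_timelike S hS hdom hu hul
    exact ⟨f, ρ, 0, hf, hρ, hρ0, le_rfl, fun h => absurd rfl h, fun i j => by rw [hSf]; ring⟩
  · push Not at htl
    obtain ⟨k, l, hk, hkl⟩ := he.exists_causal_eigenvector S hS fun u hu => hdom u u hu hu
    have hkk : g k k = 0 := by
      by_contra hne
      obtain ⟨x, hx⟩ := htl k l (lt_of_le_of_ne hk.1 (Ne.symm hne))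
      exact hx (hkl x)
    obtain ⟨f, ρ, β, hf, hρ, hρ0, hβ, hρ1, hSf⟩ := he.exists_normal_form_of_null S hS hdom hk hkk
      hkl fun u hu h => by
        obtain ⟨x, hx⟩ := htl u l hu
        exact hx (h x)
    exact ⟨f, ρ, β, hf, hρ, hρ0, hβ.le, fun _ => hρ1, hSf⟩

end NormalForms

/-! ### Null bases adapted to the flag of a frame -/

section NullBases

variable {V : Type*} [AddCommGroup V] [Module ℝ V] {N : ℕ} {g : LinearMap.BilinForm ℝ V}

/-- Two linearly independent families that span the same space have proportional exterior
products. -/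
lemma wedgeVec_eq_smul_of_mem_span {p : ℕ} {v w : Fin p → V} (hv : LinearIndependent ℝ v)
    (h : ∀ i, v i ∈ Submodule.span ℝ (Set.range w)) :
    ∃ c : ℝ, c ≠ 0 ∧ wedgeVec g v = c • wedgeVec g w := by
  choose M hM using fun i => (Submodule.mem_span_range_iff_exists_fun ℝ).1 (h i)
  refine ⟨(Matrix.of M).det, fun h0 => ?_, ?_⟩
  · obtain ⟨y, hy0, hy⟩ := Matrix.exists_vecMul_eq_zero_iff.2 h0
    refine hy0 (funext (Fintype.linearIndependent_iff.1 hv y ?_))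
    simp_rw [← hM, smul_sum, smul_smul]
    rw [sum_comm]
    refine sum_eq_zero fun j _ => ?_
    rw [← sum_smul]
    have := congrFun hy j
    simp only [Matrix.vecMul, dotProduct, Matrix.of_apply, Pi.zero_apply] at this
    rw [this, zero_smul]
  · ext x
    rw [AlternatingMap.smul_apply, wedgeVec_apply, wedgeVec_apply, smul_eq_mul, mul_comm,
      ← Matrix.det_transpose (Matrix.of M), ← Matrix.det_mul]
    congr 1
    ext i j
    simp only [Matrix.of_apply, Matrix.mul_apply, Matrix.transpose_apply]
    rw [← hM j]
    simp [mul_comm]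

/-- Multiples of the exterior product of independent vectors are zero or simple. -/
lemma IsFrame.smul_wedgeVec_isSimple {e : Module.Basis (Fin N) ℝ V} (he : IsFrame g e) {p : ℕ}
    (hp : 1 ≤ p) {v : Fin p → V} (hv : LinearIndependent ℝ v) (a : ℝ) :
    a • wedgeVec g v = 0 ∨ IsSimple (a • wedgeVec g v) := by
  rcases eq_or_ne a 0 with rfl | ha
  · simp
  obtain ⟨p, rfl⟩ : ∃ q, p = q + 1 := ⟨p - 1, by omega⟩
  right
  have hg : LinearMap.ker g = ⊥ := by
    rw [LinearMap.ker_eq_bot']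
    intro x hx
    rw [← he.sum_raised x]
    simp [hx]
  have hli : LinearIndependent ℝ fun i => g (v i) := hv.map' g hg
  -- The scalar is absorbed into the first factor.
  refine ⟨_, hli.units_smul fun i => if i = 0 then Units.mk0 a ha else 1, ?_⟩
  ext x
  change a * wedgeVec g v x = Matrix.det (Matrix.of fun i j => _)
  rw [wedgeVec_apply]
  have h1 := Matrix.det_mul_row (fun i : Fin (p + 1) => if i = 0 then a else 1)
    (Matrix.of fun i j => g (v j) (x i))
  rw [prod_ite_eq' univ (0 : Fin (p + 1)) fun _ => a, if_pos (mem_univ _)] at h1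
  rw [← h1]
  congr 1
  ext i j
  by_cases hj : j = 0
  · simp [hj]
  · simp [hj]

section NullBasis

variable {n : ℕ} {f : Module.Basis (Fin (n + 2)) ℝ V}

lemma IsFrame.apply_zero_zero (hf : IsFrame g f) : g (f 0) (f 0) = 1 := by
  rw [hf]; simp [sig]

lemma IsFrame.apply_self (hf : IsFrame g f) {i : Fin (n + 2)} (hi : i ≠ 0) :
    g (f i) (f i) = -1 := by
  rw [hf, if_pos rfl, sig, if_neg fun h : i.val = 0 => hi (Fin.ext h)]

lemma IsFrame.isNull_add (hf : IsFrame g f) {i : Fin (n + 2)} (hi : i ≠ 0) :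
    IsNull g (f 0 + f i) := by
  refine ⟨fun h => ?_, ?_⟩
  · have := congrArg (g (f 0)) h
    rw [map_add, hf.apply_zero_zero, hf, if_neg hi.symm, map_zero] at this
    norm_num at this
  · simp only [map_add, LinearMap.add_apply, hf.apply_zero_zero, hf.apply_self hi]
    rw [hf, hf, if_neg hi, if_neg hi.symm]
    norm_num

lemma IsFrame.isNull_sub (hf : IsFrame g f) {i : Fin (n + 2)} (hi : i ≠ 0) :
    IsNull g (f 0 - f i) := by
  refine ⟨fun h => ?_, ?_⟩
  · have := congrArg (g (f 0)) h
    rw [map_sub, hf.apply_zero_zero, hf, if_neg hi.symm, map_zero] at this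
    norm_num at this
  · simp only [map_sub, LinearMap.sub_apply, hf.apply_zero_zero, hf.apply_self hi]
    rw [hf, hf, if_neg hi, if_neg hi.symm]
    norm_num

/-- The span of the first vectors of a basis. -/
def initialSpan (f : Module.Basis (Fin N) ℝ V) (p : ℕ) : Submodule ℝ V :=
  Submodule.span ℝ (f '' {i | i.val < p})

lemma mem_initialSpan {f : Module.Basis (Fin N) ℝ V} {p : ℕ} {i : Fin N} (hi : i.val < p) :
    f i ∈ initialSpan f p :=
  Submodule.subset_span ⟨i, hi, rfl⟩

lemma initialSpan_mono (f : Module.Basis (Fin N) ℝ V) {p q : ℕ} (h : p ≤ q) :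
    initialSpan f p ≤ initialSpan f q :=
  Submodule.span_mono (Set.image_mono fun _ hi => lt_of_lt_of_le hi h)

lemma initialSpan_eq (f : Module.Basis (Fin N) ℝ V) {p : ℕ} (hp : p ≤ N) :
    initialSpan f p = Submodule.span ℝ (Set.range fun i : Fin p => f (Fin.castLE hp i)) := by
  refine le_antisymm (Submodule.span_mono ?_) (Submodule.span_mono ?_)
  · rintro _ ⟨i, hi, rfl⟩
    exact ⟨⟨i, hi⟩, rfl⟩
  · rintro _ ⟨i, rfl⟩
    exact ⟨Fin.castLE hp i, i.is_lt, rfl⟩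

lemma linearIndependent_castLE (f : Module.Basis (Fin N) ℝ V) {p : ℕ} (hp : p ≤ N) :
    LinearIndependent ℝ fun i : Fin p => f (Fin.castLE hp i) :=
  f.linearIndependent.comp _ (Fin.castLE_injective hp)

lemma finrank_initialSpan (f : Module.Basis (Fin N) ℝ V) {p : ℕ} (hp : p ≤ N) :
    Module.finrank ℝ (initialSpan f p) = p := by
  rw [initialSpan_eq f hp, finrank_span_eq_card (linearIndependent_castLE f hp), Fintype.card_fin]

lemma span_eq_initialSpan (f : Module.Basis (Fin N) ℝ V) {p : ℕ} (hp : p ≤ N) {q : Fin p → V}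
    (hq : LinearIndependent ℝ q) (h : ∀ i, q i ∈ initialSpan f p) :
    Submodule.span ℝ (Set.range q) = initialSpan f p := by
  have : FiniteDimensional ℝ V := f.finiteDimensional_of_finite
  refine Submodule.eq_of_le_of_finrank_le ?_ ?_
  · rw [Submodule.span_le]
    rintro _ ⟨i, rfl⟩
    exact h i
  · rw [finrank_initialSpan f hp, finrank_span_eq_card hq, Fintype.card_fin]

/-- Independent null vectors that span the same space as the first vectors of a frame extend to a
basis of null vectors adapted to the flag of the frame. -/
lemma IsFrame.exists_null_basis (hf : IsFrame g f) {b : ℕ} (hb : 1 ≤ b) (hbn : b ≤ n + 2)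
    {q : Fin b → V} (hq : LinearIndependent ℝ q) (hqn : ∀ i, IsNull g (q i))
    (hqf : ∀ i, q i ∈ initialSpan f b) :
    ∃ m : Fin (n + 2) → V, LinearIndependent ℝ m ∧ (∀ i, IsNull g (m i)) ∧
      (∀ (i : Fin b) (j : Fin (n + 2)), i.val = j.val → m j = q i) ∧
      ∀ p, b ≤ p → ∀ i : Fin (n + 2), i.val < p → m i ∈ initialSpan f p := by
  -- Since `f 0` is in the span of `q`, each later `f 0 + f i` adds exactly the direction `f i`, so
  -- the flag is respected.
  let m : Fin (n + 2) → V := fun i => if h : i.val < b then q ⟨i, h⟩ else f 0 + f i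
  have hm1 : ∀ i (h : i.val < b), m i = q ⟨i, h⟩ := fun i h => dif_pos h
  have hm2 : ∀ i, ¬ i.val < b → m i = f 0 + f i := fun i h => dif_neg h
  have hspan := span_eq_initialSpan f hbn hq hqf
  refine ⟨m, ?_, fun i => ?_, fun i j hij => ?_, fun p hp i hi => ?_⟩
  · have h1 : initialSpan f b ≤ Submodule.span ℝ (Set.range m) := by
      rw [← hspan]
      refine Submodule.span_mono ?_
      rintro _ ⟨i, rfl⟩
      exact ⟨Fin.castLE hbn i, hm1 _ i.is_lt⟩
    have h0 : f 0 ∈ Submodule.span ℝ (Set.range m) := h1 (mem_initialSpan (by simp; omega))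
    refine linearIndependent_of_top_le_span_of_card_eq_finrank ?_ ?_
    · rw [← f.span_eq, Submodule.span_le]
      rintro _ ⟨i, rfl⟩
      by_cases h : i.val < b
      · exact h1 (mem_initialSpan h)
      · have h2 : m i ∈ Submodule.span ℝ (Set.range m) := Submodule.subset_span ⟨i, rfl⟩
        rw [hm2 i h] at h2
        exact (Submodule.add_mem_iff_right _ h0).1 h2
    · simp [Module.finrank_eq_card_basis f]
  · by_cases h : i.val < b
    · rw [hm1 i h]; exact hqn _
    · rw [hm2 i h]
      exact hf.isNull_add fun h0 => h (by simp [h0]; omega)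
  · rw [hm1 j (hij ▸ i.is_lt)]
    congr 1
    exact Fin.ext hij.symm
  · by_cases h : i.val < b
    · rw [hm1 i h]; exact initialSpan_mono f hp (hqf _)
    · rw [hm2 i h]
      exact add_mem (mem_initialSpan (by simp; omega)) (mem_initialSpan hi)

end NullBasis

/-! ### Telescoping coefficients -/

section Coefficients

variable {n : ℕ}

/-- The eigenvalues of a dominant tensor, continued by the opposite of the first one. -/
def extendedEigenvalue (ρ : Fin (n + 2) → ℝ) (j : ℕ) : ℝ :=
  if h : j < n + 2 then ρ ⟨j, h⟩ else -ρ 0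

/-- The coefficients in the decomposition of a diagonalizable dominant tensor. -/
def coefficient (ρ : Fin (n + 2) → ℝ) (p : ℕ) : ℝ :=
  (extendedEigenvalue ρ (p - 1) - extendedEigenvalue ρ p) / 2

variable {ρ : Fin (n + 2) → ℝ}

lemma extendedEigenvalue_antitone (hρ : Antitone ρ) (hρ0 : ∀ i, -ρ 0 ≤ ρ i) :
    Antitone (extendedEigenvalue ρ) := by
  intro i j hij
  unfold extendedEigenvalue
  split_ifs with h1 h2 h2
  · exact hρ hij
  · omega
  · exact hρ0 _
  · exact le_rfl

lemma coefficient_nonneg (hρ : Antitone ρ) (hρ0 : ∀ i, -ρ 0 ≤ ρ i) (p : ℕ) :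
    0 ≤ coefficient ρ p := by
  have := extendedEigenvalue_antitone hρ hρ0 (Nat.sub_le p 1)
  unfold coefficient
  linarith

/-- The gaps up to rank `i` enter with sign `-`, the later ones with `+`. Both parts telescope, and
the end values `ρ 0` and `-ρ 0` cancel; this is why the sequence is continued by `-ρ 0`. -/
lemma sum_coefficient (ρ : Fin (n + 2) → ℝ) (i : Fin (n + 2)) :
    ∑ p ∈ Icc 1 (n + 2), coefficient ρ p * (if i.val < p then 1 else -1) = ρ i := by
  have h1 : ∀ M, ∑ p ∈ Icc 1 M, coefficient ρ p * (if i.val < p then 1 else -1) =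
      if M ≤ i.val then -(extendedEigenvalue ρ 0 - extendedEigenvalue ρ M) / 2
      else extendedEigenvalue ρ i -
        (extendedEigenvalue ρ 0 + extendedEigenvalue ρ M) / 2 := by
    intro M
    induction M with
    | zero => simp
    | succ M ih =>
      rw [sum_Icc_succ_top (by omega), ih]
      unfold coefficient
      rw [Nat.add_sub_cancel]
      rcases lt_trichotomy M i.val with h | h | h
      · rw [if_pos h.le, if_neg (by omega), if_pos (by omega)]; ring
      · rw [if_pos h.le, if_pos (by omega), if_neg (by omega), h]; ring
      · rw [if_neg (by omega), if_pos (by omega), if_neg (by omega)]; ring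
  rw [h1, if_neg (by omega)]
  simp [extendedEigenvalue]

end Coefficients

/-! ### Decomposition of the normal form -/

section Decomposition

variable {n : ℕ} {e f : Module.Basis (Fin (n + 2)) ℝ V}

lemma IsFrame.apply_eq_of_diagonal (hf : IsFrame g f) {S : LinearMap.BilinForm ℝ V}
    {ρ : Fin (n + 2) → ℝ} {β : ℝ} {k : V}
    (hSf : ∀ i j, S (f i) (f j) = ρ i * g (f i) (f j) + β * (g k (f i) * g k (f j))) (x y : V) :
    S x y = ∑ i, ρ i * (sig i * (g (f i) x * g (f i) y)) + β * (g k x * g k y) := by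
  have h : S = ∑ i, (ρ i * sig i) • LinearMap.BilinForm.linMulLin (g (f i)) (g (f i)) +
      β • LinearMap.BilinForm.linMulLin (g k) (g k) := by
    refine LinearMap.BilinForm.ext_basis f fun i j => ?_
    rw [hSf]
    simp only [LinearMap.add_apply, LinearMap.sum_apply, LinearMap.smul_apply,
      LinearMap.BilinForm.linMulLin_apply, smul_eq_mul]
    congr 1
    rw [sum_eq_single i]
    · rw [hf i i, if_pos rfl]
      linear_combination -(ρ i * g (f i) (f j)) * sig_mul_self i
    · intro l _ hl
      rw [hf l i, if_neg hl]
      ring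
    · simp
  conv_lhs => rw [h]
  simp only [LinearMap.add_apply, LinearMap.sum_apply, LinearMap.smul_apply,
    LinearMap.BilinForm.linMulLin_apply, smul_eq_mul, mul_assoc]

/-- The forms in the decomposition of a dominant tensor in normal form. -/
def normalForm (g : LinearMap.BilinForm ℝ V) (f : Module.Basis (Fin (n + 2)) ℝ V)
    (ρ : Fin (n + 2) → ℝ) (β : ℝ) (p : ℕ) : V [⋀^Fin p]→ₗ[ℝ] ℝ :=
  if p = 1 ∧ β ≠ 0 then Real.sqrt β • wedgeVec g fun _ => f 0 + f 1
  else if hp : p ≤ n + 2 then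
    Real.sqrt (2 * coefficient ρ p) • wedgeVec g fun i => f (Fin.castLE hp i)
  else 0

variable {ρ : Fin (n + 2) → ℝ} {β : ℝ}

lemma normalForm_of_le {p : ℕ} (hp : p ≤ n + 2) (h : ¬(p = 1 ∧ β ≠ 0)) :
    normalForm g f ρ β p =
      Real.sqrt (2 * coefficient ρ p) • wedgeVec g fun i => f (Fin.castLE hp i) := by
  rw [normalForm, if_neg h, dif_pos hp]

lemma normalForm_one (h : β ≠ 0) :
    normalForm g f ρ β 1 = Real.sqrt β • wedgeVec g fun _ => f 0 + f 1 := by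
  rw [normalForm, if_pos ⟨rfl, h⟩]

lemma IsFrame.normalForm_isSimple (hf : IsFrame g f) {p : ℕ} (hp : 1 ≤ p) (hpN : p ≤ n + 2) :
    normalForm g f ρ β p = 0 ∨ IsSimple (normalForm g f ρ β p) := by
  by_cases h : p = 1 ∧ β ≠ 0
  · obtain ⟨rfl, hβ⟩ := h
    rw [normalForm_one hβ]
    refine hf.smul_wedgeVec_isSimple le_rfl ?_ _
    exact LinearIndependent.of_subsingleton 0 (hf.isNull_add (i := 1) (by simp)).1
  · rw [normalForm_of_le hpN h]
    exact hf.smul_wedgeVec_isSimple hp (linearIndependent_castLE f hpN) _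

lemma IsFrame.apply_eq_sum_superenergy (he : IsFrame g e) (hf : IsFrame g f)
    {S : LinearMap.BilinForm ℝ V} (hρ : Antitone ρ) (hρ0 : ∀ i, -ρ 0 ≤ ρ i) (hβ : 0 ≤ β)
    (hβρ : β ≠ 0 → ρ 1 = ρ 0)
    (hSf : ∀ i j, S (f i) (f j) =
      ρ i * g (f i) (f j) + β * (g (f 0 + f 1) (f i) * g (f 0 + f 1) (f j))) (x y : V) :
    S x y = ∑ p ∈ Icc 1 (n + 2), superenergy g e (normalForm g f ρ β p) x y := by
  have h1 : ∀ p ∈ Icc 1 (n + 2), superenergy g e (normalForm g f ρ β p) x y =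
      ∑ i : Fin (n + 2), coefficient ρ p * (if i.val < p then 1 else -1) *
        (sig i * (g (f i) x * g (f i) y)) +
      if p = 1 then β * (g (f 0 + f 1) x * g (f 0 + f 1) y) else 0 := by
    intro p hp
    rw [mem_Icc] at hp
    by_cases h : p = 1 ∧ β ≠ 0
    · obtain ⟨rfl, hβ0⟩ := h
      -- No diagonal term of rank 1 is lost when the null 1-form takes its place.
      have hc : coefficient ρ 1 = 0 := by
        have h0 : extendedEigenvalue ρ 0 = ρ 0 := dif_pos (by omega)
        have h1 : extendedEigenvalue ρ 1 = ρ 1 := dif_pos (by omega)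
        rw [coefficient, h0, h1, hβρ hβ0, sub_self, zero_div]
      rw [normalForm_one hβ0, superenergy_smul, Real.sq_sqrt hβ,
        he.superenergy_null hf (i₀ := 0) (i₁ := 1) rfl rfl, hc]
      simp
    · rw [normalForm_of_le hp.2 h, superenergy_smul,
        Real.sq_sqrt (mul_nonneg zero_le_two (coefficient_nonneg hρ hρ0 p)),
        he.superenergy_wedgeVec_frame hf hp.1 hp.2]
      have h2 : (if p = 1 then β * (g (f 0 + f 1) x * g (f 0 + f 1) y) else 0) = 0 := by
        split_ifs with h3
        · have : β = 0 := by by_contra hne; exact h ⟨h3, hne⟩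
          rw [this, zero_mul]
        · rfl
      rw [h2, add_zero, mul_sum, mul_sum]
      exact sum_congr rfl fun i _ => by ring
  rw [sum_congr rfl h1, sum_add_distrib, sum_comm, hf.apply_eq_of_diagonal hSf]
  congr 1
  · refine sum_congr rfl fun i _ => ?_
    rw [← sum_mul, sum_coefficient]
  · rw [sum_ite_eq']
    simp

/-- The forms of the normal form are multiples of the exterior products of the vectors of a basis
adapted to the frame. -/
lemma normalForm_eq_smul {b : ℕ} {m : Fin (n + 2) → V} (hm : LinearIndependent ℝ m)
    (hmf : ∀ p, b ≤ p → ∀ i : Fin (n + 2), i.val < p → m i ∈ initialSpan f p)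
    (hb : ∀ p, 2 ≤ p → p < b → coefficient ρ p = 0) {p : ℕ} (hp : 2 ≤ p) (hpN : p ≤ n + 2) :
    ∃ c : ℝ, normalForm g f ρ β p = c • wedgeVec g fun i : Fin p => m (Fin.castLE hpN i) := by
  rw [normalForm_of_le hpN (by omega)]
  rcases lt_or_ge p b with h | h
  · exact ⟨0, by rw [hb p hp h]; simp⟩
  · obtain ⟨c, hc, hcm⟩ := wedgeVec_eq_smul_of_mem_span (g := g)
      (hm.comp _ (Fin.castLE_injective hpN)) (w := fun i => f (Fin.castLE hpN i)) fun i => by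
        rw [← initialSpan_eq f hpN]
        exact hmf p h _ i.is_lt
    refine ⟨Real.sqrt (2 * coefficient ρ p) / c, ?_⟩
    change _ = _ • wedgeVec g (m ∘ Fin.castLE hpN)
    rw [hcm, smul_smul, div_mul_cancel₀ _ hc]

end Decomposition

end NullBases

/-! ### Null eigenvectors of the normal form -/

section MainLemmas

variable {V : Type*} [AddCommGroup V] [Module ℝ V] {N : ℕ} {g : LinearMap.BilinForm ℝ V}
  {n d : ℕ} {e f : Module.Basis (Fin (n + 2)) ℝ V} {S : LinearMap.BilinForm ℝ V}
  {ρ : Fin (n + 2) → ℝ} {β : ℝ} {k : Fin d → V}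

/-- The number of eigenvalues equal to the first one. -/
lemma exists_card_first_eigenvalue (hρ : Antitone ρ) :
    ∃ m, 1 ≤ m ∧ m ≤ n + 2 ∧ ∀ i, ρ i = ρ 0 ↔ i.val < m := by
  classical
  by_cases h : ∃ j : ℕ, ∃ hj : j < n + 2, ρ ⟨j, hj⟩ ≠ ρ 0
  · obtain ⟨hj, hne⟩ := Nat.find_spec h
    refine ⟨Nat.find h, ?_, hj.le, fun i => ⟨fun hi => ?_, fun hi => ?_⟩⟩
    · by_contra! h0
      exact hne (congrArg ρ (Fin.ext (Nat.lt_one_iff.1 h0)))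
    · by_contra! hle
      have h1 : ρ i ≤ ρ ⟨Nat.find h, hj⟩ := hρ hle
      have h2 : ρ ⟨Nat.find h, hj⟩ ≤ ρ 0 := hρ (Fin.zero_le _)
      exact hne (le_antisymm h2 (hi.ge.trans h1))
    · by_contra hne
      exact Nat.find_min h hi ⟨i.is_lt, hne⟩
  · push Not at h
    exact ⟨n + 2, by omega, le_rfl, fun i => ⟨fun _ => i.is_lt, fun _ => h _ i.is_lt⟩⟩

lemma coefficient_eq_zero {m : ℕ} (hmn : m ≤ n + 2) (hm : ∀ i, ρ i = ρ 0 ↔ i.val < m) {p : ℕ}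
    (hp : p < m) : coefficient ρ p = 0 := by
  have h : ∀ j, j < m → extendedEigenvalue ρ j = ρ 0 := fun j hj => by
    rw [extendedEigenvalue, dif_pos (by omega)]
    exact (hm _).2 hj
  rw [coefficient, h _ (by omega), h _ hp, sub_self, zero_div]

/-- The first strict drop occurs at `m`. If all eigenvalues coincide, it is the final drop from `ρ
0` to `-ρ 0`, whence the positivity assumption. -/
lemma coefficient_pos (hρ : Antitone ρ) (hρ0 : 0 < ρ 0) {m : ℕ} (hm1 : 1 ≤ m) (hmn : m ≤ n + 2)
    (hm : ∀ i, ρ i = ρ 0 ↔ i.val < m) : 0 < coefficient ρ m := by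
  have h1 : extendedEigenvalue ρ (m - 1) = ρ 0 := by
    rw [extendedEigenvalue, dif_pos (by omega)]
    exact (hm _).2 (by simp; omega)
  have h2 : extendedEigenvalue ρ m < ρ 0 := by
    unfold extendedEigenvalue
    split_ifs with h
    · refine lt_of_le_of_ne (hρ (Fin.zero_le _)) fun heq => ?_
      exact absurd ((hm _).1 heq) (lt_irrefl m)
    · linarith
  rw [coefficient, h1]
  linarith

lemma coefficient_one_pos (hρ : Antitone ρ) (h : ρ 1 ≠ ρ 0) : 0 < coefficient ρ 1 := by
  have h0 : extendedEigenvalue ρ 0 = ρ 0 := dif_pos (by omega)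
  have h1 : extendedEigenvalue ρ 1 = ρ 1 := dif_pos (by omega)
  have : ρ 1 < ρ 0 := lt_of_le_of_ne (hρ (Fin.zero_le _)) h
  rw [coefficient, h0, h1]
  linarith

/-- A null vector is not orthogonal to a timelike one. -/
lemma IsFrame.apply_ne_zero_of_isNull (hf : IsFrame g f) {v : V} (hv : IsNull g v) :
    g (f 0) v ≠ 0 := fun h =>
  hv.1 (hf.eq_zero_of_orthogonal (u := f 0) (by rw [hf.apply_zero_zero]; norm_num) h hv.2.ge)

/-- A null vector has a non-zero component along `f 0`, which forces its eigenvalue to be `ρ 0`; the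
components with other eigenvalues vanish. -/
lemma IsFrame.mem_initialSpan_of_isEigenvector (hf : IsFrame g f)
    (hSd : ∀ i x, S x (f i) = ρ i * g x (f i)) {m : ℕ} (hm : ∀ i, ρ i = ρ 0 ↔ i.val < m)
    (hS : ∀ x y, S x y = S y x) {v : V}
    (hv : IsNull g v) (hve : IsEigenvector g S v) : v ∈ initialSpan f m := by
  obtain ⟨μ, hμ⟩ := hve.2
  have h1 : ∀ i, (ρ i - μ) * g (f i) v = 0 := fun i => by
    have h2 := hμ (f i)
    rw [hS, hSd, hf.symm] at h2
    linarith
  have hμ0 : μ = ρ 0 := by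
    have := (mul_eq_zero.1 (h1 0)).resolve_right (hf.apply_ne_zero_of_isNull hv)
    linarith
  rw [← hf.sum_raised v]
  refine sum_mem fun i _ => ?_
  by_cases hi : i.val < m
  · exact Submodule.smul_mem _ _ (mem_initialSpan hi)
  · have h2 : g (f i) v = 0 := (mul_eq_zero.1 (h1 i)).resolve_left fun h => hi ((hm i).1 (by
      linarith))
    rw [raised, map_smul, hf.symm, h2, smul_zero, zero_smul]
    exact zero_mem _

/-- For `m ≥ 2` the eigenspace is spanned by its null vectors `f 0 ± f i`, which belong to the span
of `k` by maximality. -/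
lemma IsFrame.initialSpan_eq_span (hf : IsFrame g f)
    (hSd : ∀ i x, S x (f i) = ρ i * g x (f i)) {m : ℕ} (hm : ∀ i, ρ i = ρ 0 ↔ i.val < m)
    (hS : ∀ x y, S x y = S y x) (hm2 : 2 ≤ m)
    (hk : IsMaxNullEigenfamily g S k) : Submodule.span ℝ (Set.range k) = initialSpan f m := by
  refine le_antisymm ?_ ?_
  · rw [Submodule.span_le]
    rintro _ ⟨i, rfl⟩
    exact hf.mem_initialSpan_of_isEigenvector hSd hm hS (hk.2.1 i).1 (hk.2.1 i).2
  · have hadd : ∀ i : Fin (n + 2), i.val < m → i ≠ 0 →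
        f 0 + f i ∈ Submodule.span ℝ (Set.range k) := fun i hi hi0 =>
      hk.2.2 _ (hf.isNull_add hi0) ⟨(hf.isNull_add hi0).1, ρ 0, fun w => by
        rw [map_add, map_add, hSd, hSd, (hm i).2 hi, mul_add]⟩
    have hsub : ∀ i : Fin (n + 2), i.val < m → i ≠ 0 →
        f 0 - f i ∈ Submodule.span ℝ (Set.range k) := fun i hi hi0 =>
      hk.2.2 _ (hf.isNull_sub hi0) ⟨(hf.isNull_sub hi0).1, ρ 0, fun w => by
        rw [map_sub, map_sub, hSd, hSd, (hm i).2 hi, mul_sub]⟩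
    have h0 : f 0 ∈ Submodule.span ℝ (Set.range k) := by
      have h1 := Submodule.smul_mem _ (1 / 2 : ℝ) (add_mem (hadd 1 (by simp; omega) (by simp))
        (hsub 1 (by simp; omega) (by simp)))
      have h2 : (1 / 2 : ℝ) • (f 0 + f 1 + (f 0 - f 1)) = f 0 := by module
      rwa [h2] at h1
    rw [initialSpan, Submodule.span_le]
    rintro _ ⟨i, hi, rfl⟩
    rcases eq_or_ne i 0 with rfl | hi0
    · exact h0
    · exact (Submodule.add_mem_iff_right _ h0).1 (hadd i hi hi0)

/-- If the tensor is not diagonalizable, the null eigenvectors have the same direction. -/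
lemma IsFrame.mem_span_of_isEigenvector (hf : IsFrame g f) (hβ : β ≠ 0) (hρ1 : ρ 1 = ρ 0)
    (hSx : ∀ i x, S (f i) x = ρ i * g (f i) x + β * (g (f 0 + f 1) x * g (f 0 + f 1) (f i)))
    {v : V} (hv : IsNull g v) (hve : IsEigenvector g S v) :
    v ∈ Submodule.span ℝ {f 0 + f 1} := by
  obtain ⟨μ, hμ⟩ := hve.2
  have hk0 : g (f 0 + f 1) (f 0) = 1 := by
    rw [map_add, LinearMap.add_apply, hf.apply_zero_zero, hf, if_neg (by simp), add_zero]
  have hk1 : g (f 0 + f 1) (f 1) = -1 := by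
    rw [map_add, LinearMap.add_apply, hf.apply_self (by simp), hf, if_neg (by simp), zero_add]
  have hkk := (hf.isNull_add (i := 1) (by simp)).2
  have h0 := hμ (f 0)
  have h1 := hμ (f 1)
  rw [hSx, hk0] at h0
  rw [hSx, hk1, hρ1] at h1
  have ha : g (f 0 + f 1) v = g (f 0) v + g (f 1) v := by simp
  -- In the sum of `h0` and `h1` the `β` terms cancel. Were this product non-zero, `μ` would equal
  -- `ρ 0`, and `h0` alone would give a contradiction.
  have hkv : g (f 0 + f 1) v = 0 := by
    by_contra hne
    have h2 : (ρ 0 - μ) * g (f 0 + f 1) v = 0 := by rw [ha]; linarith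
    have h3 : ρ 0 = μ := by linarith [(mul_eq_zero.1 h2).resolve_right hne]
    rw [h3] at h0
    have h4 : β * g (f 0 + f 1) v = 0 := by linarith
    exact (mul_ne_zero hβ hne) h4
  rw [Submodule.mem_span_singleton]
  refine ⟨g (f 0) v, ?_⟩
  -- The difference of `v` and this multiple is orthogonal to `f 0` and has norm zero, hence
  -- vanishes.
  refine (sub_eq_zero.1 (hf.eq_zero_of_orthogonal (u := f 0)
    (by rw [hf.apply_zero_zero]; norm_num) ?_ ?_)).symm
  · rw [map_sub, map_smul, hf.symm _ (f 0 + f 1), hk0, smul_eq_mul, mul_one, sub_self]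
  · simp only [map_sub, map_smul, LinearMap.sub_apply, LinearMap.smul_apply, smul_eq_mul, hkk,
      hv.2, hf.symm v (f 0 + f 1), hkv]
    simp

/-- The two null vectors spanning the first plane of a frame. -/
lemma IsFrame.linearIndependent_null_pair (hf : IsFrame g f) {a : ℝ} (ha : a ≠ 0) :
    LinearIndependent ℝ ![a • (f 0 + f 1), f 0 - f 1] := by
  rw [LinearIndependent.pair_iff]
  intro s t h
  have h0 := congrArg (g (f 0)) h
  have h1 := congrArg (g (f 1)) h
  have h01 : g (f 0) (f 1) = 0 := by rw [hf, if_neg (by simp)]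
  simp only [map_add, map_sub, map_smul, hf.apply_zero_zero, hf.apply_self (i := 1) (by simp), h01,
    hf.symm (f 1) (f 0), smul_eq_mul, map_zero] at h0 h1
  have h2 : s * a = 0 := by linarith
  have h3 := (mul_eq_zero.1 h2).resolve_right ha
  refine ⟨h3, ?_⟩
  rw [h3] at h0
  linarith

lemma IsNull.smul {v : V} (hv : IsNull g v) {a : ℝ} (ha : a ≠ 0) : IsNull g (a • v) :=
  ⟨smul_ne_zero ha hv.1, by simp [hv.2]⟩

lemma IsFrame.exists_null_basis_pair (hf : IsFrame g f) {a : ℝ} (ha : a ≠ 0) :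
    ∃ m : Fin (n + 2) → V, LinearIndependent ℝ m ∧ (∀ i, IsNull g (m i)) ∧
      m 0 = a • (f 0 + f 1) ∧
      ∀ p, 2 ≤ p → ∀ i : Fin (n + 2), i.val < p → m i ∈ initialSpan f p := by
  have h0 : f 0 ∈ initialSpan f 2 := mem_initialSpan (by simp)
  have h1 : f 1 ∈ initialSpan f 2 := mem_initialSpan (by simp)
  obtain ⟨m, hm, hmn, hmq, hmf⟩ := hf.exists_null_basis (b := 2) (by omega) (by omega)
    (hf.linearIndependent_null_pair ha) (fun i => by
      fin_cases i
      · exact (hf.isNull_add (by simp)).smul ha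
      · exact hf.isNull_sub (by simp)) (fun i => by
      fin_cases i
      · exact Submodule.smul_mem _ _ (add_mem h0 h1)
      · exact sub_mem h0 h1)
  exact ⟨m, hm, hmn, hmq 0 0 rfl, hmf⟩

end MainLemmas

end Superenergy
end

/-! ### Assembly: one-dimensional top eigenspace, larger top eigenspace, non-diagonalizable case -/

theorem mainTheorem3 {V : Type*} [AddCommGroup V] [Module ℝ V] (N : ℕ) (hN : 2 ≤ N)
    (g : LinearMap.BilinForm ℝ V) (e : Module.Basis (Fin N) ℝ V) (he : Superenergy.IsFrame g e)
    (S : LinearMap.BilinForm ℝ V) (hsymm : ∀ x y, S x y = S y x)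
    (hdom : Superenergy.Dominant g (e ⟨0, by omega⟩) S)
    (d : ℕ) (k : Fin d → V) (hk : Superenergy.IsMaxNullEigenfamily g S k) :
    ∃ (Ω : (p : ℕ) → V [⋀^Fin p]→ₗ[ℝ] ℝ) (n : Fin N → V),
      -- the decomposition into superenergy tensors of (possibly absent) simple forms
      (∀ x y, S x y = ∑ p ∈ Finset.Icc 1 N, Superenergy.superenergy g e (Ω p) x y) ∧
      (∀ p, 1 ≤ p → p ≤ N → Ω p = 0 ∨ Superenergy.IsSimple (Ω p)) ∧
      -- for `p > 1` the form is a multiple of the product of the first `p` vectors of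
      -- a null basis that begins with the null eigenvectors of `S`
      LinearIndependent ℝ n ∧ (∀ i, Superenergy.IsNull g (n i)) ∧
      (∀ (i : Fin d) (j : Fin N), i.val = j.val → n j = k i) ∧
      (∀ p, 2 ≤ p → ∀ hp : p ≤ N,
        ∃ c : ℝ, Ω p = c • Superenergy.wedgeVec g fun i : Fin p => n (Fin.castLE hp i)) ∧
      -- there are null eigenvectors
      (∀ p, 1 ≤ p → p < d → Ω p = 0) ∧
      (1 ≤ d → ∃ c : ℝ, (S ≠ 0 → c ≠ 0) ∧ Ω d = c • Superenergy.wedgeVec g k) ∧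
      -- there is no null eigenvector
      (d = 0 → ∃ u : V, Superenergy.IsTimelike g u ∧ Superenergy.IsEigenvector g S u ∧
        Ω 1 = Superenergy.wedgeVec g fun _ : Fin 1 => u) := by
  open Superenergy in
  obtain ⟨n, rfl⟩ : ∃ n, N = n + 2 := ⟨N - 2, by omega⟩
  obtain ⟨f, ρ, β, hf, hρ, hρ0, hβ, hβρ, hSf⟩ := he.exists_normal_form S hsymm hdom
  have hS := he.apply_eq_sum_superenergy hf hρ hρ0 hβ hβρ hSf
  have hsimple : ∀ p, 1 ≤ p → p ≤ n + 2 →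
      normalForm g f ρ β p = 0 ∨ IsSimple (normalForm g f ρ β p) :=
    fun p hp hpN => hf.normalForm_isSimple hp hpN
  have hSx : ∀ i x, S (f i) x = ρ i * g (f i) x +
      β * (g (f 0 + f 1) x * g (f 0 + f 1) (f i)) := fun i x => by
    have h : S (f i) = ρ i • g (f i) + (β * g (f 0 + f 1) (f i)) • g (f 0 + f 1) :=
      f.ext fun j => by
        rw [hSf]
        simp only [LinearMap.add_apply, LinearMap.smul_apply, smul_eq_mul]
        ring
    rw [h]
    simp only [LinearMap.add_apply, LinearMap.smul_apply, smul_eq_mul]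
    ring
  rcases eq_or_ne β 0 with rfl | hβ0
  · have hSd : ∀ i x, S x (f i) = ρ i * g x (f i) := fun i x => by
      rw [hsymm, hSx, hf.symm x]; ring
    obtain ⟨m, hm1, hmn, hm⟩ := exists_card_first_eigenvalue hρ
    rcases hm1.eq_or_lt with rfl | hm2
    -- Null eigenvectors would be multiples of the timelike `f 0`.
    · have hd : d = 0 := by
        by_contra hd
        obtain ⟨h1, h2⟩ := hk.2.1 ⟨0, by omega⟩
        have h3 := hf.mem_initialSpan_of_isEigenvector hSd hm hsymm h1 h2
        have h4 : k ⟨0, by omega⟩ ∈ Submodule.span ℝ {f 0} := by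
          refine Submodule.span_mono ?_ h3
          rintro _ ⟨i, hi, rfl⟩
          have : i = 0 := Fin.ext (by simpa using hi)
          simp [this]
        obtain ⟨a, ha⟩ := Submodule.mem_span_singleton.1 h4
        have h5 := h1.2
        have h6 := h1.1
        rw [← ha] at h5 h6
        simp only [map_smul, LinearMap.smul_apply, smul_eq_mul, hf.apply_zero_zero, mul_one,
          mul_self_eq_zero] at h5
        exact h6 (by rw [h5, zero_smul])
      subst hd
      obtain ⟨w, hw, hwn, -, hwf⟩ := hf.exists_null_basis_pair one_ne_zero
      refine ⟨normalForm g f ρ 0, w, hS, hsimple, hw, hwn, fun i => i.elim0,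
        fun p hp hpN => normalForm_eq_smul hw hwf (fun p h1 h2 => absurd h2 (by omega)) hp hpN,
        fun p _ h => absurd h (by omega), fun h => absurd h (by omega), fun _ => ?_⟩
      have hc : 0 < Real.sqrt (2 * coefficient ρ 1) := Real.sqrt_pos.2 (by
        have := coefficient_one_pos hρ fun h => absurd ((hm 1).1 h) (by simp)
        linarith)
      refine ⟨Real.sqrt (2 * coefficient ρ 1) • f 0, ?_, ⟨smul_ne_zero hc.ne' (f.ne_zero 0), ρ 0,
        fun x => ?_⟩, ?_⟩
      · simp only [IsTimelike, map_smul, LinearMap.smul_apply, smul_eq_mul, hf.apply_zero_zero]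
        positivity
      · simp only [map_smul, smul_eq_mul, hSd]; ring
      · rw [normalForm_of_le (by omega) (by simp)]
        ext x
        simp [wedgeVec_apply]
    · have hspan := hf.initialSpan_eq_span hSd hm hsymm hm2 hk
      obtain rfl : m = d := by
        rw [← finrank_initialSpan f hmn, ← hspan, finrank_span_eq_card hk.1, Fintype.card_fin]
      have hkm : ∀ i, k i ∈ initialSpan f m := fun i => by
        rw [← hspan]
        exact Submodule.subset_span ⟨i, rfl⟩
      obtain ⟨w, hw, hwn, hwk, hwf⟩ := hf.exists_null_basis (by omega) hmn hk.1
        (fun i => (hk.2.1 i).1) hkm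
      have hc0 : ∀ p, p < m → coefficient ρ p = 0 := fun p hp => coefficient_eq_zero hmn hm hp
      refine ⟨normalForm g f ρ 0, w, hS, hsimple, hw, hwn, hwk,
        fun p hp hpN => normalForm_eq_smul hw hwf (fun p _ h2 => hc0 p h2) hp hpN,
        fun p h1 h2 => ?_, fun _ => ?_, fun h => absurd h (by omega)⟩
      · rw [normalForm_of_le (by omega) (by simp), hc0 p h2]
        simp
      · obtain ⟨c, hc, hck⟩ := wedgeVec_eq_smul_of_mem_span (g := g) hk.1
          (w := fun i => f (Fin.castLE hmn i)) fun i => by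
            rw [← initialSpan_eq f hmn]
            exact hkm i
        refine ⟨Real.sqrt (2 * coefficient ρ m) / c, fun hS0 => div_ne_zero ?_ hc, ?_⟩
        -- The bounds `-ρ 0 ≤ ρ i ≤ ρ 0` show that `S` vanishes unless `ρ 0` is positive.
        · have hpos : 0 < ρ 0 := by
            by_contra! hneg
            refine hS0 (LinearMap.BilinForm.ext_basis f fun i j => ?_)
            have h1 : ρ i = 0 := by
              have h2 := hρ0 i
              have h3 := hρ0 0
              have h4 := hρ (Fin.zero_le i)
              linarith
            rw [hSf, h1]
            simp
          have := coefficient_pos hρ hpos hm1 hmn hm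
          exact (Real.sqrt_pos.2 (by linarith)).ne'
        · rw [normalForm_of_le hmn (by simp), hck, smul_smul, div_mul_cancel₀ _ hc]
  · have hnull := hf.isNull_add (i := 1) (by simp)
    have hmem : ∀ i, k i ∈ Submodule.span ℝ {f 0 + f 1} := fun i =>
      hf.mem_span_of_isEigenvector hβ0 (hβρ hβ0) hSx (hk.2.1 i).1 (hk.2.1 i).2
    have hspan : Submodule.span ℝ (Set.range k) = Submodule.span ℝ {f 0 + f 1} := by
      refine le_antisymm (Submodule.span_le.2 ?_) (Submodule.span_le.2 ?_)
      · rintro _ ⟨i, rfl⟩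
        exact hmem i
      · rintro _ rfl
        refine hk.2.2 _ hnull ⟨hnull.1, ρ 0, fun x => ?_⟩
        have h1 : S (f 0 + f 1) x = ρ 0 * g (f 0 + f 1) x := by
          rw [map_add, map_add, LinearMap.add_apply, hSx, hSx, hβρ hβ0]
          have h2 := hnull.2
          rw [map_add (g (f 0 + f 1))] at h2
          rw [LinearMap.add_apply]
          linear_combination β * g (f 0 + f 1) x * h2
        rw [hsymm, h1, hf.symm]
    obtain rfl : d = 1 := by
      have h1 := finrank_span_eq_card hk.1
      rw [hspan, finrank_span_singleton hnull.1, Fintype.card_fin] at h1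
      exact h1.symm
    obtain ⟨a, ha⟩ := Submodule.mem_span_singleton.1 (hmem 0)
    have ha0 : a ≠ 0 := by
      rintro rfl
      exact (hk.2.1 0).1.1 (by rw [← ha, zero_smul])
    obtain ⟨w, hw, hwn, hw0, hwf⟩ := hf.exists_null_basis_pair ha0
    refine ⟨normalForm g f ρ β, w, hS, hsimple, hw, hwn, fun i j hij => ?_,
      fun p hp hpN => normalForm_eq_smul hw hwf (fun p h1 h2 => absurd h2 (by omega)) hp hpN,
      fun p h1 h2 => absurd h2 (by omega), fun _ => ?_, fun h => absurd h (by omega)⟩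
    · obtain rfl : i = 0 := Subsingleton.elim _ _
      obtain rfl : j = 0 := Fin.ext hij.symm
      rw [hw0, ha]
    · refine ⟨Real.sqrt β / a, fun _ => div_ne_zero
        (Real.sqrt_pos.2 (lt_of_le_of_ne hβ hβ0.symm)).ne' ha0, ?_⟩
      rw [normalForm_one hβ0]
      ext x
      simp only [AlternatingMap.smul_apply, wedgeVec_apply, Matrix.det_fin_one, Matrix.of_apply,
        ← ha, map_smul, LinearMap.smul_apply, smul_eq_mul]
      field_simp
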